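/- For integers $2\le k\le n/2$ and $p\in(0,1)$, let $\mathcal H^k(n,p)$ be the random $k$-uniform hypergraph on the vertex set $[n]=\{1,\dots,n\}$ in which each $k$-element subset of $[n]$ is an edge independently with probability $p$. For a $k$-uniform hypergraph $\mathcal H$, let $i(\mathcal H)$ be the largest number of edges in a subfamily $\mathcal F\subseteq\mathcal H$ that is intersecting, i.e. $A\cap B\neq\emptyset$ for all $A,B\in\mathcal F$. Put $N=\binom nk$ and $D=\binom{n-k}k$. Limits are taken as $n\to\infty$, $a(n)\ll b(n)$ means $a(n)/b(n)\to0$, "almost surely as $n\to\infty$" means with probability tending to $1$ as $n\to\infty$, and $X=(1\pm\epsilon)Y$ means $(1-\epsilon)Y\le X\le(1+\epsilon)Y$. **Theorem.** For every $0<\epsilon<1$ there is a constant $C=C(\epsilon)>0$ such that the following holds for all sequences $p=p(n)\in(0,1)$ and $k=k(n)\in\mathbb N$ with $2\le k\le n/2$ (for all large $n$). Almost surely as $n\to\infty$: 1. $i(\mathcal H^k(n,p))=(1\pm\epsilon)\,pN$, if $N^{-1}\ll p\ll D^{-1}$; 2. $i(\mathcal H^k(n,p))\ge(1-\epsilon)\frac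 ND\ln(pD)$, if $D^{-1}\ll p\le\frac nk D^{-1}$ and $k\gg\sqrt{n\ln n}$; 3. $i(\mathcal H^k(n,p))\le C\,\frac ND\ln(pD)$, if $D^{-1}\ll p\le\left(\frac nk\right)^{1-\epsilon}D^{-1}$; 4. $i(\mathcal H^k(n,p))=(1\pm\epsilon)\,p\,\frac kn N$, if $p\ge C\,\frac nk\ln^2\!\left(\frac nk\right)D^{-1}$. -/

import Mathlib

open Filter Topology Asymptotics MeasureTheory ProbabilityTheory

/-- The law of the binomial random `k`-uniform hypergraph `H^k(n,p)` on the vertex set `Fin n`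
(a hypergraph is identified with its set of edges): each `k`-element subset of `Fin n` is an edge
independently with probability `p`, and no other set is an edge. -/
noncomputable def randomHypergraph (n k : ℕ) (p : unitInterval) :
    Measure (Set (Finset (Fin n))) :=
  setBernoulli {e : Finset (Fin n) | e.card = k} p

open Classical in
/-- `i(H)`: the largest number of edges of an intersecting subhypergraph of `H`, that is, of a
family `F ⊆ H` any two members of which have non-empty intersection. -/
noncomputable def maxIntersecting {n : ℕ} (H : Set (Finset (Fin n))) : ℕ :=
  (Finset.univ.filter fun F : Finset (Finset (Fin n)) =>
    (F : Set (Finset (Fin n))) ⊆ H ∧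
      ∀ A ∈ F, ∀ B ∈ F, (A ∩ B).Nonempty).sup Finset.card

/-- The property `P n` of hypergraphs on `n` vertices holds asymptotically almost surely for
`H^k(n,p)`, where `k = k(n)` and `p = p(n)`: its probability tends to `1` as `n → ∞`. -/
def HoldsAAS (k : ℕ → ℕ) (p : ℕ → unitInterval)
    (P : ∀ n : ℕ, Set (Finset (Fin n)) → Prop) : Prop :=
  Tendsto (fun n : ℕ => randomHypergraph n (k n) (p n) {H | P n H}) atTop (𝓝 1)

/-- `N = C(n,k)` as a real number. -/
noncomputable def kneserOrder (k : ℕ → ℕ) (n : ℕ) : ℝ := (n.choose (k n) : ℝ)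

/-- `D = C(n-k,k)` as a real number (used only for `k ≤ n/2`). -/
noncomputable def kneserDegree (k : ℕ → ℕ) (n : ℕ) : ℝ := ((n - k n).choose (k n) : ℝ)

/-! Intersecting families of `k`-sets are the independent sets of the Kneser graph, which has `N`
vertices and is `D`-regular. So `i(H)` is the independence number of the subgraph induced on a
`p`-random set of vertices, with about `pN` vertices and typical degree `pD`.

Lower bounds. If `pD → 0`, the expected number of adjacent pairs is `o(pN)`, and deleting a vertex
from each costs nothing (the matching upper bound is the total number of edges of `H`). If `pD → ∞`
and `k ≫ √(n ln n)`, then `C(n-2k,k) ≤ D/n³`, so few vertices lie in triangles. After removing these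
and the vertices of large degree, Shearer's theorem for triangle-free graphs
(`exists_indep_ge_of_triangleFree`) gives about `pN · ln(pD)/(pD) = (N/D) ln(pD)`. In the dense
range a star, with mean `p(k/n)N`, is concentrated.

Upper bounds. Averaging Katona's circle argument over all cyclic orders, with Cauchy–Schwarz, yields
`kneser_supersaturation`: a family of more than `(1+δ)(k/n)N` sets has a member disjoint from at
least a `(D/N)·δ/(1+δ)` fraction of it. Fed into the Kleitman–Winston algorithm
(`exists_containers`), this covers every independent set by a fingerprint of about `(N/D) log(1/r)`
vertices and a container of at most `rN` vertices, for any `r ≥ (1+δ)k/n`. A union bound over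
fingerprints with an exponential moment for each container gives
`randomHypergraph_real_maxIntersecting_ge`.

Both upper bounds are choices of `r`. In the sparse range `r = 2(pD)^{-1/(1-ε)}`, so that
fingerprint and container both contribute `O((N/D) ln(pD))`. In the dense range `r = (1+ε/4)k/n`;
the fingerprint entropy, of order `(N/D) ln²(n/k)`, is then negligible against `p(k/n)N`, which is
exactly the assumed lower bound on `p`. -/

/-! ### Moments of counts in a binomial random set -/

section RandomSubset

variable {α : Type*} {M : Set α} (p : unitInterval)

/-- The probability that a binomial random subset of `M` contains `T`. -/
theorem setBernoulli_real_superset [Finite α] {T : Finset α} (hT : (T : Set α) ⊆ M) :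
    (setBernoulli M p).real {H | (T : Set α) ⊆ H} = (p : ℝ) ^ T.card := by
  classical
  rw [measureReal_def, setBernoulli_apply']
  have : ((fun p : α → Prop ↦ {i | p i}) ⁻¹' {H | (T : Set α) ⊆ H})
      = Set.pi (T : Set α) (fun _ => {True}) := by
    ext f
    simp [Set.subset_def, Set.mem_pi]
  rw [this, Measure.infinitePi_pi _ (by simp)]
  rw [Finset.prod_congr rfl (g := fun _ => (unitInterval.toNNReal p : ENNReal))]
  · simp
  · intro i hi
    have hiM : i ∈ M := hT hi
    rw [Measure.add_apply, Measure.smul_apply, Measure.smul_apply]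
    simp [hiM, ENNReal.smul_def]

open Classical in
/-- The indicator function of the event `T ⊆ H`. -/
noncomputable def subsetIndicator (T : Finset α) (H : Set α) : ℝ :=
  if (T : Set α) ⊆ H then 1 else 0

open Classical in
/-- The number of elements of `U` that belong to `H`. -/
noncomputable def hitCount (U : Finset α) (H : Set α) : ℕ := (U.filter (· ∈ H)).card

theorem subsetIndicator_nonneg (T : Finset α) (H : Set α) : 0 ≤ subsetIndicator T H := by
  unfold subsetIndicator; split_ifs <;> norm_num

theorem subsetIndicator_of_subset {T : Finset α} {H : Set α} (h : (T : Set α) ⊆ H) :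
    subsetIndicator T H = 1 := if_pos h

theorem subsetIndicator_empty (H : Set α) : subsetIndicator (∅ : Finset α) H = 1 :=
  subsetIndicator_of_subset (by simp)

theorem subsetIndicator_mul [DecidableEq α] (T U : Finset α) (H : Set α) :
    subsetIndicator T H * subsetIndicator U H = subsetIndicator (T ∪ U) H := by
  unfold subsetIndicator
  by_cases h1 : (T : Set α) ⊆ H <;> by_cases h2 : (U : Set α) ⊆ H <;>
    simp [h1, h2, Finset.coe_union]

theorem hitCount_eq_sum (U : Finset α) (H : Set α) :
    (hitCount U H : ℝ) = ∑ a ∈ U, subsetIndicator {a} H := by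
  classical
  unfold hitCount subsetIndicator
  rw [Finset.card_filter]
  push_cast
  exact Finset.sum_congr rfl fun a _ => by simp

variable [Fintype α]

theorem integral_subsetIndicator {T : Finset α} (hT : (T : Set α) ⊆ M) :
    ∫ H, subsetIndicator T H ∂(setBernoulli M p) = (p : ℝ) ^ T.card := by
  rw [← setBernoulli_real_superset p hT, ← integral_indicator_one (by measurability)]
  refine integral_congr_ae (ae_of_all _ fun H => ?_)
  simp [subsetIndicator, Set.indicator]

theorem integral_subsetIndicator_mul_hitCount {T U : Finset α} (hT : (T : Set α) ⊆ M)
    (hU : (U : Set α) ⊆ M) (hTU : Disjoint T U) :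
    ∫ H, subsetIndicator T H * (hitCount U H : ℝ) ∂(setBernoulli M p)
      = (p : ℝ) ^ T.card * (U.card * p) := by
  classical
  simp_rw [hitCount_eq_sum, Finset.mul_sum, subsetIndicator_mul]
  rw [integral_finsetSum _ fun _ _ => Integrable.of_finite]
  rw [Finset.sum_congr rfl (g := fun _ => (p : ℝ) ^ T.card * p)]
  · simp; ring
  · intro a ha
    rw [integral_subsetIndicator, Finset.card_union_of_disjoint]
    · simp [pow_succ]
    · exact Finset.disjoint_singleton_right.2 (Finset.disjoint_right.1 hTU ha)
    · simp only [Finset.coe_union, Finset.coe_singleton, Set.union_subset_iff]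
      exact ⟨hT, by simpa using hU ha⟩

/-- The square expands over ordered pairs `(a, b)`; a diagonal pair requires only one new element
and so has weight `p` instead of `p²`. -/
theorem integral_subsetIndicator_mul_hitCount_sq {T U : Finset α} (hT : (T : Set α) ⊆ M)
    (hU : (U : Set α) ⊆ M) (hTU : Disjoint T U) :
    ∫ H, subsetIndicator T H * (hitCount U H : ℝ) ^ 2 ∂(setBernoulli M p)
      = (p : ℝ) ^ T.card * (U.card * p + U.card * (U.card - 1) * p ^ 2) := by
  classical
  have key : ∀ a ∈ U, ∀ b ∈ U,
      ∫ H, subsetIndicator (T ∪ ({a} ∪ {b})) H ∂(setBernoulli M p)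
        = (p : ℝ) ^ T.card * (p ^ 2 + if a = b then (p : ℝ) - p ^ 2 else 0) := by
    intro a ha b hb
    rw [integral_subsetIndicator, Finset.card_union_of_disjoint, pow_add]
    · by_cases hab : a = b
      · simp [hab]
      · rw [if_neg hab, Finset.card_union_of_disjoint (by simpa using hab)]
        simp
    · simp only [Finset.disjoint_union_right, Finset.disjoint_singleton_right]
      exact ⟨Finset.disjoint_right.1 hTU ha, Finset.disjoint_right.1 hTU hb⟩
    · simp only [Finset.coe_union, Finset.coe_singleton, Set.union_subset_iff]
      exact ⟨hT, by simpa using hU ha, by simpa using hU hb⟩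
  have : ∀ H : Set α, subsetIndicator T H * (hitCount U H : ℝ) ^ 2
      = ∑ a ∈ U, ∑ b ∈ U, subsetIndicator (T ∪ ({a} ∪ {b})) H := by
    intro H
    rw [hitCount_eq_sum, sq, Finset.sum_mul_sum, Finset.mul_sum]
    refine Finset.sum_congr rfl fun a _ => ?_
    rw [Finset.mul_sum]
    exact Finset.sum_congr rfl fun b _ => by rw [subsetIndicator_mul, subsetIndicator_mul]
  simp_rw [this]
  rw [integral_finsetSum _ fun _ _ => Integrable.of_finite]
  rw [Finset.sum_congr rfl fun a ha => by
    rw [integral_finsetSum _ fun _ _ => Integrable.of_finite, Finset.sum_congr rfl (key a ha),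
      ← Finset.mul_sum, Finset.sum_add_distrib, Finset.sum_ite_eq, if_pos ha]]
  simp
  ring

/-- Conditional variance of a binomial count. -/
theorem integral_subsetIndicator_mul_sq_sub {T U : Finset α} (hT : (T : Set α) ⊆ M)
    (hU : (U : Set α) ⊆ M) (hTU : Disjoint T U) :
    ∫ H, subsetIndicator T H * ((hitCount U H : ℝ) - U.card * p) ^ 2 ∂(setBernoulli M p)
      = (p : ℝ) ^ T.card * (U.card * p * (1 - p)) := by
  have : ∀ H : Set α, subsetIndicator T H * ((hitCount U H : ℝ) - U.card * p) ^ 2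
      = subsetIndicator T H * (hitCount U H : ℝ) ^ 2
        - 2 * (U.card * p) * (subsetIndicator T H * (hitCount U H : ℝ))
        + (U.card * p) ^ 2 * subsetIndicator T H := fun H => by ring
  simp_rw [this]
  rw [integral_add Integrable.of_finite Integrable.of_finite,
    integral_sub Integrable.of_finite Integrable.of_finite, integral_const_mul,
    integral_const_mul, integral_subsetIndicator_mul_hitCount_sq p hT hU hTU,
    integral_subsetIndicator_mul_hitCount p hT hU hTU, integral_subsetIndicator p hT]
  ring

/-- Markov's inequality for a function on a finite probability space. -/
theorem measureReal_le_integral_div {Ω : Type*} [MeasurableSpace Ω] [DiscreteMeasurableSpace Ω]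
    [Finite Ω] (μ : Measure Ω) [IsProbabilityMeasure μ] {g : Ω → ℝ} (hg : ∀ ω, 0 ≤ g ω)
    {c : ℝ} (hc : 0 < c) {E : Set Ω} (hE : ∀ ω ∈ E, c ≤ g ω) :
    μ.real E ≤ (∫ ω, g ω ∂μ) / c := by
  rw [le_div_iff₀ hc, mul_comm]
  refine le_trans ?_ (mul_meas_ge_le_integral_of_nonneg (ae_of_all _ hg) Integrable.of_finite c)
  exact mul_le_mul_of_nonneg_left (measureReal_mono fun ω h => hE ω h) hc.le

/-- Chebyshev's inequality for binomial counts. -/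
theorem measureReal_abs_hitCount_sub_ge {U : Finset α} (hU : (U : Set α) ⊆ M) {s : ℝ}
    (hs : 0 < s) :
    (setBernoulli M p).real {H | s ≤ |(hitCount U H : ℝ) - U.card * p|} ≤ U.card * p / s ^ 2 := by
  have h0 : (0 : ℝ) ≤ p := p.2.1
  have h1 : (p : ℝ) ≤ 1 := p.2.2
  refine (measureReal_le_integral_div (setBernoulli M p)
    (g := fun H => subsetIndicator ∅ H * ((hitCount U H : ℝ) - U.card * p) ^ 2)
    (fun H => mul_nonneg (subsetIndicator_nonneg _ _) (sq_nonneg _))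
    (c := s ^ 2) (by positivity) ?_).trans ?_
  · intro H hH
    rw [subsetIndicator_empty, one_mul, ← sq_abs ((hitCount U H : ℝ) - U.card * p)]
    exact pow_le_pow_left₀ hs.le hH 2
  · rw [integral_subsetIndicator_mul_sq_sub p (by simp) hU (by simp)]
    refine div_le_div_of_nonneg_right ?_ (sq_nonneg s)
    rw [Finset.card_empty, pow_zero, one_mul]
    exact mul_le_of_le_one_right (mul_nonneg (Nat.cast_nonneg _) h0) (by linarith)

/-- The moment generating function of a binomial count. -/
theorem integral_subsetIndicator_mul_pow_hitCount {T U : Finset α} (hT : (T : Set α) ⊆ M)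
    (hU : (U : Set α) ⊆ M) (hTU : Disjoint T U) (s : ℝ) :
    ∫ H, subsetIndicator T H * (1 + s) ^ hitCount U H ∂(setBernoulli M p)
      = (p : ℝ) ^ T.card * (1 + s * p) ^ U.card := by
  classical
  -- Expanding `∏ (1 + s·1_{a ∈ H})` over subsets `W ⊆ U` reduces the generating function to
  -- containment probabilities.
  have : ∀ H : Set α, subsetIndicator T H * (1 + s) ^ hitCount U H
      = ∑ W ∈ U.powerset, s ^ W.card * subsetIndicator (T ∪ W) H := by
    intro H
    have h1 : (1 + s) ^ hitCount U H = ∏ a ∈ U, (1 + s * subsetIndicator {a} H) := by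
      rw [hitCount, ← Finset.prod_const, Finset.prod_filter]
      refine Finset.prod_congr rfl fun a _ => ?_
      by_cases h : a ∈ H <;> simp [subsetIndicator, h]
    rw [h1, Finset.prod_one_add, Finset.mul_sum]
    refine Finset.sum_congr rfl fun W _ => ?_
    rw [Finset.prod_mul_distrib, Finset.prod_const, ← subsetIndicator_mul]
    have h2 : ∀ W : Finset α, ∏ a ∈ W, subsetIndicator {a} H = subsetIndicator W H := by
      intro W
      induction W using Finset.induction_on with
      | empty => simp [subsetIndicator_empty]
      | insert a W ha ih =>
        rw [Finset.prod_insert ha, ih, subsetIndicator_mul, Finset.insert_eq]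
    rw [h2 W]; ring
  simp_rw [this]
  rw [integral_finsetSum _ fun _ _ => Integrable.of_finite]
  have h3 : ∀ W ∈ U.powerset, ∫ H, s ^ W.card * subsetIndicator (T ∪ W) H ∂(setBernoulli M p)
      = (p : ℝ) ^ T.card * ∏ _a ∈ W, (s * p) := by
    intro W hW
    rw [Finset.mem_powerset] at hW
    rw [integral_const_mul, integral_subsetIndicator,
      Finset.card_union_of_disjoint (hTU.mono_right hW), Finset.prod_const, pow_add, mul_pow]
    · ring
    · simp only [Finset.coe_union, Set.union_subset_iff]
      exact ⟨hT, (Finset.coe_subset.2 hW).trans hU⟩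
  rw [Finset.sum_congr rfl h3, ← Finset.mul_sum, ← Finset.prod_one_add, Finset.prod_const]

end RandomSubset

/-! ### Graph containers and the union bound over fingerprints -/

section Containers

variable {α : Type*}

/-- No two (possibly equal) members of `I` are related by `adj`. -/
def IsIndep (adj : α → α → Prop) (I : Finset α) : Prop := ∀ a ∈ I, ∀ b ∈ I, ¬ adj a b

theorem IsIndep.mono {adj : α → α → Prop} {I J : Finset α} (h : IsIndep adj J) (hIJ : I ⊆ J) :
    IsIndep adj I := fun a ha b hb => h a (hIJ ha) b (hIJ hb)

open Classical in
/-- The Kleitman–Winston container lemma: if every set with more than `R` elements contains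
a vertex with at least a `b`-fraction of the set as neighbours, then all independent sets are
covered by few sets of size at most `R`. -/
theorem exists_containers (adj : α → α → Prop) {b R : ℝ} (hb : b ≤ 1) (hR : 0 ≤ R)
    (hdeg : ∀ S : Finset α, R < S.card →
      ∃ v ∈ S, ∃ B ⊆ S, (∀ w ∈ B, adj v w) ∧ b * S.card ≤ B.card) :
    ∀ (m : ℕ) (A : Finset α) (q : ℕ), A.card ≤ m → (A.card : ℝ) * (1 - b) ^ q ≤ R →
      ∃ C : Finset α → Finset α, (∀ T, ((C T).card : ℝ) ≤ R) ∧
        ∀ I ⊆ A, IsIndep adj I → ∃ T ⊆ I, T.card ≤ q ∧ I ⊆ T ∪ C T := by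
  intro m
  induction m with
  | zero =>
    intro A q hA _
    refine ⟨fun _ => ∅, fun _ => by simpa using hR, fun I hI _ => ⟨∅, by simp, by simp, ?_⟩⟩
    rw [Nat.le_zero, Finset.card_eq_zero] at hA
    subst hA
    simpa using hI
  | succ m ih =>
    intro A q hA hq
    by_cases hAR : (A.card : ℝ) ≤ R
    · exact ⟨fun _ => A, fun _ => hAR, fun I hI _ => ⟨∅, by simp, by simp, by simpa using hI⟩⟩
    rw [not_le] at hAR
    obtain ⟨v, hvA, B, hBA, hB, hv⟩ := hdeg A hAR
    obtain ⟨q, rfl⟩ : ∃ r, q = r + 1 := by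
      cases q with
      | zero => simp at hq; linarith
      | succ r => exact ⟨r, rfl⟩
    have hErase : (A.erase v).card ≤ m := by
      rw [Finset.card_erase_of_mem hvA]; omega
    obtain ⟨C₂, hC₂, hI₂⟩ := ih (A.erase v) (q + 1) hErase (by
      refine le_trans (mul_le_mul_of_nonneg_right ?_ (pow_nonneg (by linarith) _)) hq
      exact_mod_cast Finset.card_le_card (Finset.erase_subset v A))
    set A' := (A.erase v).filter (fun w => ¬ adj v w) with hA'
    have hA'card : (A'.card : ℝ) ≤ (1 - b) * A.card := by
      have h1 : A'.card ≤ (A.filter (fun w => ¬ adj v w)).card :=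
        Finset.card_le_card (Finset.filter_subset_filter _ (Finset.erase_subset v A))
      have h2 := Finset.card_filter_add_card_filter_not (s := A) (adj v)
      have h3 : ((A.filter (adj v)).card : ℝ) + (A.filter (fun w => ¬ adj v w)).card = A.card := by
        exact_mod_cast h2
      have h4 : (A'.card : ℝ) ≤ (A.filter (fun w => ¬ adj v w)).card := by exact_mod_cast h1
      have h5 : (B.card : ℝ) ≤ (A.filter (adj v)).card := by
        exact_mod_cast Finset.card_le_card fun w hw => Finset.mem_filter.2 ⟨hBA hw, hB w hw⟩
      linarith
    obtain ⟨C₁, hC₁, hI₁⟩ := ih A' q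
      ((Finset.card_le_card (Finset.filter_subset _ _)).trans hErase) (by
      refine le_trans (mul_le_mul_of_nonneg_right hA'card (pow_nonneg (by linarith) _)) ?_
      rw [pow_succ] at hq
      linarith)
    -- The container may depend on the fingerprint only. Since `v` is put into `T` exactly when `v ∈
    -- I`, testing `v ∈ T` recovers the branch taken: `v ∈ I` spends one unit of `q` and discards
    -- the neighbours of `v`, while `v ∉ I` discards just `v`.
    refine ⟨fun T => if v ∈ T then C₁ (T.erase v) else C₂ T, fun T => ?_, fun I hIA hI => ?_⟩
    · by_cases h : v ∈ T <;> simp [h, hC₁, hC₂]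
    · by_cases hvI : v ∈ I
      · obtain ⟨T, hT, hTq, hIT⟩ := hI₁ (I.erase v) (by
          intro w hw
          rw [Finset.mem_erase] at hw
          simp only [hA', Finset.mem_filter, Finset.mem_erase]
          exact ⟨⟨hw.1, hIA hw.2⟩, hI v hvI w hw.2⟩) (hI.mono (Finset.erase_subset _ _))
        have hvT : v ∉ T := fun h => Finset.notMem_erase v I (hT h)
        refine ⟨insert v T, ?_, ?_, ?_⟩
        · exact Finset.insert_subset hvI (hT.trans (Finset.erase_subset _ _))
        · rw [Finset.card_insert_of_notMem hvT]; omega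
        · simp only [Finset.mem_insert_self, if_true, Finset.erase_insert hvT]
          rw [Finset.insert_union, ← Finset.insert_erase hvI]
          exact Finset.insert_subset_insert _ hIT
      · obtain ⟨T, hT, hTq, hIT⟩ := hI₂ I (fun w hw =>
          Finset.mem_erase.2 ⟨fun h => hvI (h ▸ hw), hIA hw⟩) hI
        have hvT : v ∉ T := fun h => hvI (hT h)
        exact ⟨T, hT, hTq, by simpa [hvT] using hIT⟩

/-- An upper bound for the probability that a binomial random set contains a large
independent set, by a union bound over containers. -/
theorem measureReal_exists_indep_le [Fintype α] (adj : α → α → Prop) (p : unitInterval)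
    (A : Finset α) {b R u θ t : ℝ} (q : ℕ) (hb : b ≤ 1) (hR : 0 ≤ R)
    (hdeg : ∀ S : Finset α, S ⊆ A → R < S.card →
      ∃ v ∈ S, ∃ B ⊆ S, (∀ w ∈ B, adj v w) ∧ b * S.card ≤ B.card)
    (hq : (A.card : ℝ) * (1 - b) ^ q ≤ R) (hu0 : 0 < u) (hu1 : u ≤ 1) (hθ : 0 ≤ θ) :
    (setBernoulli (A : Set α) p).real
        {H | ∃ I : Finset α, (I : Set α) ⊆ H ∧ IsIndep adj I ∧ t ≤ I.card}
      ≤ Real.exp (q * Real.log (1 / u) + p * A.card * u + p * R * (Real.exp θ - 1)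
          - θ * (t - q)) := by
  classical
  have hp0 : (0 : ℝ) ≤ p := p.2.1
  set μ := setBernoulli (A : Set α) p
  -- The container lemma asks for a vertex of large degree in every finite set, not only in subsets
  -- of `A`. Joining each vertex outside `A` to everything makes this automatic and leaves
  -- independence inside `A` unchanged.
  set adjA : α → α → Prop := fun v w => (v ∈ A ∧ w ∈ A → adj v w) with hadjA
  obtain ⟨C, hC, hI⟩ := exists_containers adjA hb hR (by
    intro S hS
    by_cases hSA : S ⊆ A
    · obtain ⟨v, hv, B, hBS, hB, hcard⟩ := hdeg S hSA hS
      exact ⟨v, hv, B, hBS, fun w hw _ => hB w hw, hcard⟩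
    · obtain ⟨v, hv, hvA⟩ := Finset.not_subset.1 hSA
      refine ⟨v, hv, S, subset_rfl, fun w _ h => absurd h.1 hvA, ?_⟩
      exact mul_le_of_le_one_left (Nat.cast_nonneg _) hb) A.card A q le_rfl hq
  have hs : 0 ≤ Real.exp θ - 1 := by linarith [Real.one_le_exp hθ]
  set 𝒯 := A.powerset.filter (fun T => T.card ≤ q) with h𝒯
  -- Markov's inequality is applied to the whole sum over fingerprints. Removing `T` from its
  -- container makes the event `T ⊆ H` independent of the count in the rest.
  set g : Set α → ℝ := fun H => ∑ T ∈ 𝒯,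
    subsetIndicator T H * (1 + (Real.exp θ - 1)) ^ hitCount ((C T ∩ A) \ T) H with hg
  have hg0 : ∀ H, 0 ≤ g H := fun H => Finset.sum_nonneg fun T _ =>
    mul_nonneg (subsetIndicator_nonneg _ _) (pow_nonneg (by linarith) _)
  have hsub : μ.real {H | ∃ I : Finset α, (I : Set α) ⊆ H ∧ IsIndep adj I ∧ t ≤ I.card}
      ≤ μ.real {H | Real.exp (θ * (t - q)) ≤ g H} := by
    refine ENNReal.toReal_mono (measure_ne_top _ _) (measure_mono_ae ?_)
    filter_upwards [setBernoulli_ae_subset (u := (A : Set α)) (p := p)] with H hHA hH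
    obtain ⟨I, hIH, hIind, hIt⟩ := hH
    have hIA : I ⊆ A := by exact_mod_cast hIH.trans hHA
    obtain ⟨T, hTI, hTq, hIT⟩ := hI I hIA (fun a ha b hb h =>
      hIind a ha b hb (h ⟨hIA ha, hIA hb⟩))
    have hT𝒯 : T ∈ 𝒯 := Finset.mem_filter.2 ⟨Finset.mem_powerset.2 (hTI.trans hIA), hTq⟩
    have hTH : (T : Set α) ⊆ H := (Finset.coe_subset.2 hTI).trans hIH
    have hcount : t - q ≤ hitCount ((C T ∩ A) \ T) H := by
      have h1 : I.card ≤ T.card + hitCount ((C T ∩ A) \ T) H := by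
        refine le_trans (Finset.card_le_card (t := T ∪ ((C T ∩ A) \ T).filter (· ∈ H)) ?_)
          (Finset.card_union_le _ _)
        intro w hw
        by_cases hwT : w ∈ T
        · exact Finset.mem_union_left _ hwT
        · refine Finset.mem_union_right _ (Finset.mem_filter.2 ⟨Finset.mem_sdiff.2
            ⟨Finset.mem_inter.2 ⟨?_, hIA hw⟩, hwT⟩, hIH hw⟩)
          exact (Finset.mem_union.1 (hIT hw)).resolve_left hwT
      have h2 : (I.card : ℝ) ≤ T.card + hitCount ((C T ∩ A) \ T) H := by exact_mod_cast h1
      have h3 : (T.card : ℝ) ≤ q := by exact_mod_cast hTq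
      linarith
    show Real.exp (θ * (t - q)) ≤ g H
    calc Real.exp (θ * (t - q)) ≤ Real.exp (hitCount ((C T ∩ A) \ T) H * θ) := by
          rw [mul_comm]
          exact Real.exp_le_exp.2 (mul_le_mul_of_nonneg_right hcount hθ)
      _ = subsetIndicator T H * (1 + (Real.exp θ - 1)) ^ hitCount ((C T ∩ A) \ T) H := by
          rw [subsetIndicator_of_subset hTH, Real.exp_nat_mul]; simp
      _ ≤ g H := Finset.single_le_sum (f := fun T => subsetIndicator T H *
            (1 + (Real.exp θ - 1)) ^ hitCount ((C T ∩ A) \ T) H) (fun T _ =>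
            mul_nonneg (subsetIndicator_nonneg _ _) (pow_nonneg (by linarith) _)) hT𝒯
  have hint : ∫ H, g H ∂μ ≤ ∑ T ∈ 𝒯, (p : ℝ) ^ T.card * Real.exp (p * R * (Real.exp θ - 1)) := by
    rw [hg, integral_finsetSum _ fun _ _ => Integrable.of_finite]
    refine Finset.sum_le_sum fun T hT => ?_
    have hTA : T ⊆ A := Finset.mem_powerset.1 (Finset.mem_filter.1 hT).1
    rw [integral_subsetIndicator_mul_pow_hitCount p (by exact_mod_cast hTA)
      (by exact_mod_cast Finset.sdiff_subset.trans Finset.inter_subset_right)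
      Finset.disjoint_sdiff]
    refine mul_le_mul_of_nonneg_left ?_ (pow_nonneg hp0 _)
    have hsp : 0 ≤ (Real.exp θ - 1) * p := mul_nonneg hs hp0
    have hcard : ((((C T ∩ A) \ T).card : ℕ) : ℝ) ≤ R := by
      refine le_trans ?_ (hC T)
      exact_mod_cast Finset.card_le_card (Finset.sdiff_subset.trans Finset.inter_subset_left)
    calc (1 + (Real.exp θ - 1) * p) ^ ((C T ∩ A) \ T).card
        ≤ Real.exp ((Real.exp θ - 1) * p) ^ ((C T ∩ A) \ T).card :=
          pow_le_pow_left₀ (by linarith) (by linarith [Real.add_one_le_exp ((Real.exp θ - 1) * p)]) _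
      _ = Real.exp (((C T ∩ A) \ T).card * ((Real.exp θ - 1) * p)) := by rw [Real.exp_nat_mul]
      _ ≤ _ := Real.exp_le_exp.2 (by nlinarith)
  -- As `|T| ≤ q` and `u ≤ 1`, the factor `u^{|T|-q}` is at least `1`. Inserting it allows the sum
  -- to run over all subsets of `A`, where it factorises; no estimate of binomial coefficients is
  -- needed.
  have hfinger : ∑ T ∈ 𝒯, (p : ℝ) ^ T.card
      ≤ Real.exp (q * Real.log (1 / u) + p * A.card * u) := by
    calc ∑ T ∈ 𝒯, (p : ℝ) ^ T.card
        ≤ ∑ T ∈ 𝒯, (1 / u) ^ q * ∏ _a ∈ T, (p * u : ℝ) := by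
          refine Finset.sum_le_sum fun T hT => ?_
          rw [Finset.prod_const, mul_pow]
          have h1 : u ^ q ≤ u ^ T.card := pow_le_pow_of_le_one hu0.le hu1 (Finset.mem_filter.1 hT).2
          have h2 : 1 ≤ (1 / u) ^ q * u ^ T.card := by
            rw [div_pow, one_pow, div_mul_eq_mul_div, one_mul, le_div_iff₀ (pow_pos hu0 q), one_mul]
            exact h1
          have h3 : (0 : ℝ) ≤ (p : ℝ) ^ T.card := pow_nonneg hp0 _
          nlinarith
      _ ≤ ∑ T ∈ A.powerset, (1 / u) ^ q * ∏ _a ∈ T, (p * u : ℝ) :=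
          Finset.sum_le_sum_of_subset_of_nonneg (Finset.filter_subset _ _) fun T _ _ => by
            rw [Finset.prod_const]; positivity
      _ = (1 / u) ^ q * (1 + p * u) ^ A.card := by
          rw [← Finset.mul_sum, ← Finset.prod_one_add, Finset.prod_const]
      _ ≤ (1 / u) ^ q * Real.exp (p * u) ^ A.card := by
          gcongr
          linarith [Real.add_one_le_exp (p * u : ℝ)]
      _ = _ := by
          rw [Real.exp_add, ← Real.exp_nat_mul, Real.exp_nat_mul (Real.log (1 / u)),
            Real.exp_log (by positivity)]
          congr 2; ring
  refine hsub.trans ((measureReal_le_integral_div μ hg0 (Real.exp_pos _) (fun H hH => hH)).trans ?_)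
  rw [div_le_iff₀ (Real.exp_pos _), ← Real.exp_add]
  refine hint.trans ?_
  rw [← Finset.sum_mul]
  refine (mul_le_mul_of_nonneg_right hfinger (Real.exp_pos _).le).trans ?_
  rw [← Real.exp_add]
  exact Real.exp_le_exp.2 (le_of_eq (by ring))

end Containers

/-! ### Averaging over bijections: pairs of disjoint `k`-sets -/

section Supersaturation

variable {α β : Type*} [DecidableEq α] [DecidableEq β]

/-- Bijections `A → A'` and `B → B'` glue together and extend to the complements. This transitivity
is why an average over all bijections does not depend on the starting pair. -/
theorem exists_perm_map_eq {A B A' B' : Finset α} [Fintype α] (h : Disjoint A B)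
    (h' : Disjoint A' B') (hA : A.card = A'.card) (hB : B.card = B'.card) :
    ∃ τ : Equiv.Perm α, A.map τ.toEmbedding = A' ∧ B.map τ.toEmbedding = B' := by
  let e : {x // x ∈ A ∪ B} ≃ {x // x ∈ A' ∪ B'} :=
    (Equiv.Finset.union A B h).symm.trans
      ((Equiv.sumCongr (Finset.equivOfCardEq hA) (Finset.equivOfCardEq hB)).trans
        (Equiv.Finset.union A' B' h'))
  refine ⟨e.extendSubtype, ?_, ?_⟩
  · refine Finset.eq_of_subset_of_card_le (fun y hy => ?_) (by rw [Finset.card_map, hA])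
    obtain ⟨x, hx, rfl⟩ := Finset.mem_map.1 hy
    have hxe := e.extendSubtype_apply_of_mem x (Finset.mem_union_left _ hx)
    have hx' : (Equiv.Finset.union A B h).symm ⟨x, Finset.mem_union_left _ hx⟩
      = Sum.inl ⟨x, hx⟩ := (Equiv.symm_apply_eq _).2 rfl
    rw [Equiv.coe_toEmbedding, hxe]
    simp only [e, Equiv.trans_apply, Equiv.sumCongr_apply, hx', Sum.map_inl]
    exact Finset.coe_mem _
  · refine Finset.eq_of_subset_of_card_le (fun y hy => ?_) (by rw [Finset.card_map, hB])
    obtain ⟨x, hx, rfl⟩ := Finset.mem_map.1 hy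
    have hxe := e.extendSubtype_apply_of_mem x (Finset.mem_union_right _ hx)
    have hx' : (Equiv.Finset.union A B h).symm ⟨x, Finset.mem_union_right _ hx⟩
      = Sum.inr ⟨x, hx⟩ := (Equiv.symm_apply_eq _).2 rfl
    rw [Equiv.coe_toEmbedding, hxe]
    simp only [e, Equiv.trans_apply, Equiv.sumCongr_apply, hx', Sum.map_inr]
    exact Finset.coe_mem _

/-- The ordered pairs of disjoint `k`-subsets of `α`. -/
def disjointPairs (α : Type*) [DecidableEq α] [Fintype α] (k : ℕ) :
    Finset (Finset α × Finset α) :=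
  (Finset.powersetCard k Finset.univ ×ˢ Finset.powersetCard k Finset.univ).filter
    fun q => Disjoint q.1 q.2

theorem mem_disjointPairs [Fintype α] {k : ℕ} {q : Finset α × Finset α} :
    q ∈ disjointPairs α k ↔ q.1.card = k ∧ q.2.card = k ∧ Disjoint q.1 q.2 := by
  simp [disjointPairs, Finset.mem_powersetCard, and_assoc]

theorem filter_disjoint_powersetCard [Fintype α] (k : ℕ) (A : Finset α) :
    (Finset.powersetCard k Finset.univ).filter (fun B => Disjoint A B)
      = Finset.powersetCard k Aᶜ := by
  ext B
  rw [Finset.mem_filter, Finset.mem_powersetCard_univ, Finset.mem_powersetCard,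
    Finset.subset_compl_iff_disjoint_left, and_comm]

theorem sum_disjointPairs [Fintype α] (k : ℕ) (F : Finset α → Finset α → ℝ) :
    ∑ q ∈ disjointPairs α k, F q.1 q.2
      = ∑ A ∈ Finset.powersetCard k (Finset.univ : Finset α),
          ∑ B ∈ Finset.powersetCard k Aᶜ, F A B := by
  rw [disjointPairs, Finset.sum_filter, Finset.sum_product]
  refine Finset.sum_congr rfl fun A _ => ?_
  rw [← filter_disjoint_powersetCard, Finset.sum_filter]

theorem card_disjointPairs [Fintype α] (k : ℕ) :
    ((disjointPairs α k).card : ℝ)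
      = (Fintype.card α).choose k * (Fintype.card α - k).choose k := by
  have := sum_disjointPairs (α := α) k (fun _ _ => 1)
  simp only [Finset.sum_const, nsmul_eq_mul, mul_one] at this
  rw [this, Finset.sum_congr rfl (g := fun _ => (((Fintype.card α - k).choose k : ℕ) : ℝ))]
  · simp
  · intro A hA
    rw [Finset.card_powersetCard, Finset.card_compl, Finset.mem_powersetCard_univ.1 hA]

/-- Averaging over bijections: a uniformly random image of a fixed pair of disjoint `k`-sets is
a uniformly random pair of disjoint `k`-sets. -/
theorem sum_equiv_disjointPairs [Fintype α] [Fintype β] {k : ℕ} {A₀ B₀ : Finset α}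
    (hA : A₀.card = k) (hB : B₀.card = k) (hAB : Disjoint A₀ B₀)
    (F : Finset β → Finset β → ℝ) :
    (∑ e : α ≃ β, F (A₀.map e.toEmbedding) (B₀.map e.toEmbedding)) * (disjointPairs α k).card
      = Fintype.card (α ≃ β) * ∑ q ∈ disjointPairs β k, F q.1 q.2 := by
  have h1 : ∀ q ∈ disjointPairs α k,
      ∑ e : α ≃ β, F (q.1.map e.toEmbedding) (q.2.map e.toEmbedding)
        = ∑ e : α ≃ β, F (A₀.map e.toEmbedding) (B₀.map e.toEmbedding) := by
    intro q hq
    obtain ⟨h1, h2, h3⟩ := mem_disjointPairs.1 hq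
    obtain ⟨τ, hτA, hτB⟩ := exists_perm_map_eq hAB h3 (hA.trans h1.symm) (hB.trans h2.symm)
    rw [← hτA, ← hτB]
    refine Fintype.sum_equiv (Equiv.equivCongr τ.symm (Equiv.refl β)) _ _ fun e => ?_
    simp only [Finset.map_map]
    rfl
  have h2 : ∀ e : α ≃ β, ∑ q ∈ disjointPairs α k, F (q.1.map e.toEmbedding) (q.2.map e.toEmbedding)
      = ∑ q ∈ disjointPairs β k, F q.1 q.2 := by
    intro e
    refine Finset.sum_nbij' (fun q => (q.1.map e.toEmbedding, q.2.map e.toEmbedding))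
      (fun q => (q.1.map e.symm.toEmbedding, q.2.map e.symm.toEmbedding)) ?_ ?_ ?_ ?_ ?_
    · intro q hq
      rw [mem_disjointPairs] at hq ⊢
      simpa using hq
    · intro q hq
      rw [mem_disjointPairs] at hq ⊢
      simpa using hq
    · intro q _
      simp [Finset.map_map]
    · intro q _
      simp [Finset.map_map]
    · intro q _
      rfl
  calc _ = ∑ q ∈ disjointPairs α k,
        ∑ e : α ≃ β, F (q.1.map e.toEmbedding) (q.2.map e.toEmbedding) := by
        rw [Finset.sum_congr rfl h1, Finset.sum_const, nsmul_eq_mul, mul_comm]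
    _ = _ := by
        rw [Finset.sum_comm, Finset.sum_congr rfl fun e _ => h2 e]
        simp

end Supersaturation

/-! ### Katona's circle -/

section CyclicIntervals

variable {n : ℕ}

/-- The cyclic interval of length `k` starting at `i`. -/
def cyclicInterval (n k : ℕ) (i : ZMod n) : Finset (ZMod n) :=
  (Finset.range k).image fun a : ℕ => i + (a : ZMod n)

theorem card_cyclicInterval {k : ℕ} (hk : k ≤ n) (i : ZMod n) :
    (cyclicInterval n k i).card = k := by
  rw [cyclicInterval, Finset.card_image_of_injOn, Finset.card_range]
  intro a ha b hb h
  have ha' : a < n := lt_of_lt_of_le (by simpa using ha) hk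
  have hb' : b < n := lt_of_lt_of_le (by simpa using hb) hk
  have := congrArg ZMod.val (add_left_cancel h)
  rwa [ZMod.val_cast_of_lt ha', ZMod.val_cast_of_lt hb'] at this

/-- For shifts from `k` to `n - k` neither interval wraps round into the other: all offsets involved
are below `n`, so equality in `ZMod n` is equality in `ℕ`. -/
theorem disjoint_cyclicInterval {k d : ℕ} (hkd : k ≤ d) (hd : d + k ≤ n) (i : ZMod n) :
    Disjoint (cyclicInterval n k i) (cyclicInterval n k (i + d)) := by
  rw [Finset.disjoint_left]
  intro x hx hx'
  simp only [cyclicInterval, Finset.mem_image, Finset.mem_range] at hx hx'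
  obtain ⟨a, ha, rfl⟩ := hx
  obtain ⟨b, hb, h⟩ := hx'
  have h1 : ((d + b : ℕ) : ZMod n) = (a : ZMod n) := by
    push_cast
    exact add_left_cancel (by rw [← add_assoc]; exact h)
  have := congrArg ZMod.val h1
  rw [ZMod.val_cast_of_lt (by omega), ZMod.val_cast_of_lt (by omega)] at this
  omega

variable [NeZero n]

theorem sum_zmod_eq_sum_range (Y : ZMod n → ℝ) (i : ZMod n) :
    ∑ m, Y m = ∑ d ∈ Finset.range n, Y (i + (d : ZMod n)) := by
  refine Finset.sum_nbij' (fun m => (m - i).val) (fun d => i + (d : ZMod n)) ?_ ?_ ?_ ?_ ?_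
  · intro m _
    exact Finset.mem_range.2 (ZMod.val_lt _)
  · intro d _
    exact Finset.mem_univ _
  · intro m _
    simp
  · intro d hd
    simp [ZMod.val_cast_of_lt (Finset.mem_range.1 hd)]
  · intro m _
    simp

/-- A counting version of Katona's circle argument, for a `0/1`-valued `Y`. -/
theorem cyclic_count {k : ℕ} (hk : 1 ≤ k) (hkn : 2 * k ≤ n) (Y : ZMod n → ℝ)
    (hY : ∀ i, Y i = 0 ∨ Y i = 1) :
    (∑ i, Y i) * (∑ i, Y i) - k * ∑ i, Y i
      ≤ ∑ d ∈ Finset.Ico k (n - k + 1), ∑ i, Y i * Y (i + (d : ZMod n))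
        + (k - 1) * ∑ i, Y i * Y (i + (k : ZMod n)) := by
  have h0 : ∀ i, 0 ≤ Y i := fun i => by rcases hY i with h | h <;> rw [h]; norm_num
  have h1 : ∀ i, Y i ≤ 1 := fun i => by rcases hY i with h | h <;> rw [h]; norm_num
  -- The `2(k-1)` other intervals meeting the one at `i` fall into `k - 1` pairs with starting
  -- points `i + j` and `i + j - k`, each pair being disjoint; the remaining shifts `k, …, n-k` are
  -- those disjoint from it.
  have hdec : ∀ i, ∑ m, Y m = Y i + ∑ j ∈ Finset.Ico 1 k,
      (Y (i + (j : ZMod n)) + Y (i + (j : ZMod n) - (k : ZMod n)))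
        + ∑ d ∈ Finset.Ico k (n - k + 1), Y (i + (d : ZMod n)) := by
    intro i
    rw [sum_zmod_eq_sum_range Y i, Finset.range_eq_Ico,
      ← Finset.sum_Ico_consecutive _ (Nat.zero_le 1) (by omega : 1 ≤ n),
      ← Finset.sum_Ico_consecutive _ hk (by omega : k ≤ n),
      ← Finset.sum_Ico_consecutive _ (by omega : k ≤ n - k + 1) (by omega : n - k + 1 ≤ n),
      Finset.sum_add_distrib]
    have h2 : ∑ d ∈ Finset.Ico (n - k + 1) n, Y (i + (d : ZMod n))
        = ∑ j ∈ Finset.Ico 1 k, Y (i + (j : ZMod n) - (k : ZMod n)) := by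
      have := Finset.sum_Ico_add' (fun d : ℕ => Y (i + (d : ZMod n))) 1 k (n - k)
      rw [show 1 + (n - k) = n - k + 1 by omega, show k + (n - k) = n by omega] at this
      rw [← this]
      refine Finset.sum_congr rfl fun j _ => ?_
      congr 1
      rw [Nat.cast_add, Nat.cast_sub (by omega : k ≤ n), ZMod.natCast_self]
      ring
    rw [h2]
    simp
    ring
  have hone : ∀ i, Y i * (∑ m, Y m) ≤ k * Y i
      + ∑ j ∈ Finset.Ico 1 k, Y (i + (j : ZMod n) - (k : ZMod n)) * Y (i + (j : ZMod n))
      + ∑ d ∈ Finset.Ico k (n - k + 1), Y i * Y (i + (d : ZMod n)) := by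
    intro i
    have hp0 : 0 ≤ ∑ j ∈ Finset.Ico 1 k,
        Y (i + (j : ZMod n) - (k : ZMod n)) * Y (i + (j : ZMod n)) :=
      Finset.sum_nonneg fun j _ => mul_nonneg (h0 _) (h0 _)
    -- Katona's argument allows one interval from each pair. Here `y + y' ≤ 1 + yy'` charges any
    -- excess to a disjoint pair at shift `k`.
    have hs : ∑ j ∈ Finset.Ico 1 k, (Y (i + (j : ZMod n)) + Y (i + (j : ZMod n) - (k : ZMod n)))
        ≤ (k - 1) + ∑ j ∈ Finset.Ico 1 k,
          Y (i + (j : ZMod n) - (k : ZMod n)) * Y (i + (j : ZMod n)) := by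
      have : ((k : ℝ) - 1) = ∑ j ∈ Finset.Ico 1 k, (1 : ℝ) := by
        simp [Nat.cast_sub hk]
      rw [this, ← Finset.sum_add_distrib]
      refine Finset.sum_le_sum fun j _ => ?_
      nlinarith [h1 (i + (j : ZMod n)), h1 (i + (j : ZMod n) - (k : ZMod n))]
    rw [← Finset.mul_sum]
    rcases hY i with h | h
    · rw [h]; simpa using hp0
    · have := hdec i
      rw [h] at this ⊢
      linarith
  have hsum := Finset.sum_le_sum fun i (_ : i ∈ Finset.univ) => hone i
  rw [← Finset.sum_mul, Finset.sum_add_distrib, Finset.sum_add_distrib, ← Finset.mul_sum] at hsum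
  rw [Finset.sum_comm (s := Finset.univ) (t := Finset.Ico 1 k),
    Finset.sum_comm (s := Finset.univ) (t := Finset.Ico k (n - k + 1))] at hsum
  have hshift : ∀ j ∈ Finset.Ico 1 k,
      ∑ i, Y (i + (j : ZMod n) - (k : ZMod n)) * Y (i + (j : ZMod n))
        = ∑ i, Y i * Y (i + (k : ZMod n)) := by
    intro j _
    refine Fintype.sum_equiv (Equiv.addRight ((j : ZMod n) - (k : ZMod n))) _ _ fun i => ?_
    simp only [Equiv.coe_addRight]
    rw [add_sub_assoc, add_assoc, sub_add_cancel]
  rw [Finset.sum_congr rfl hshift, Finset.sum_const, Nat.card_Ico, nsmul_eq_mul,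
    Nat.cast_sub hk] at hsum
  push_cast at hsum
  linarith

end CyclicIntervals

/-! ### Supersaturation in the Kneser graph -/

section Supersaturation

variable {β : Type*} [DecidableEq β] [Fintype β]

/-- Hoffman-type supersaturation in the Kneser graph: a lower bound for the number of ordered
pairs of disjoint members of a family of `k`-sets. -/
theorem kneser_supersaturation {k n : ℕ} (hβ : Fintype.card β = n) (hk : 1 ≤ k)
    (hkn : 2 * k ≤ n) {S : Finset (Finset β)} (hS : ∀ A ∈ S, A.card = k) :
    ((n - k).choose k : ℝ) * S.card * (n * S.card - k * n.choose k)
      ≤ n.choose k * (n - k) * ∑ A ∈ S, ((S.filter (Disjoint A)).card : ℝ) := by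
  classical
  have : NeZero n := ⟨by omega⟩
  have hNpos : (0 : ℝ) < n.choose k := by exact_mod_cast Nat.choose_pos (by omega)
  have hDpos : (0 : ℝ) < (n - k).choose k := by exact_mod_cast Nat.choose_pos (by omega)
  have hcardZ : Fintype.card (ZMod n) = n := ZMod.card n
  set E := ∑ A ∈ S, ((S.filter (Disjoint A)).card : ℝ) with hE
  set f : Finset β → ℝ := fun A => if A ∈ S then 1 else 0 with hf
  set M : ℝ := ((Fintype.card (ZMod n ≃ β) : ℕ) : ℝ) with hM
  have hMpos : 0 < M := by
    rw [hM]
    have : Nonempty (ZMod n ≃ β) := ⟨Fintype.equivOfCardEq (hcardZ.trans hβ.symm)⟩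
    exact_mod_cast Fintype.card_pos
  have hSK : S ⊆ Finset.powersetCard k Finset.univ := fun A hA =>
    Finset.mem_powersetCard_univ.2 (hS A hA)
  set Y : (ZMod n ≃ β) → ZMod n → ℝ := fun e i => f ((cyclicInterval n k i).map e.toEmbedding)
    with hYdef
  have hcI : ∀ i : ZMod n, (cyclicInterval n k i).card = k :=
    card_cyclicInterval (by omega)
  -- Under a random bijection, two intervals at shift `d` become a uniform ordered pair of disjoint
  -- `k`-sets, of which there are `N·D` and of which `E` lie in `S`.
  have hpairs : ∀ (i : ZMod n) (d : ℕ), k ≤ d → d + k ≤ n →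
      ∑ e, Y e i * Y e (i + (d : ZMod n)) = M * E / (n.choose k * (n - k).choose k) := by
    intro i d hkd hd
    have := sum_equiv_disjointPairs (β := β) (hcI i) (hcI (i + d))
      (disjoint_cyclicInterval hkd hd i) (fun A B => f A * f B)
    rw [card_disjointPairs, hcardZ, sum_disjointPairs k (fun A B => f A * f B)] at this
    have hE' : ∑ A ∈ Finset.powersetCard k (Finset.univ : Finset β),
        ∑ B ∈ Finset.powersetCard k Aᶜ, f A * f B = E := by
      rw [hE, ← Finset.sum_subset hSK]
      · refine Finset.sum_congr rfl fun A hA => ?_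
        rw [← filter_disjoint_powersetCard, ← Finset.mul_sum, Finset.sum_filter]
        simp only [hf, if_pos hA, one_mul]
        rw [← Finset.sum_filter, ← Finset.sum_filter, Finset.sum_const, nsmul_eq_mul, mul_one]
        congr 2
        ext B
        simp only [Finset.mem_filter]
        exact ⟨fun h => ⟨h.2, h.1.2⟩, fun h => ⟨⟨hSK h.1, h.2⟩, h.1⟩⟩
      · intro A _ hA
        simp [hf, hA]
    rw [hE'] at this
    rw [eq_div_iff (by positivity)]
    exact this
  have hsingle : ∀ i : ZMod n, ∑ e, Y e i = M * S.card / n.choose k := by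
    intro i
    -- The second interval is a dummy: the averaging identity is stated for pairs, and the function
    -- here ignores the second set.
    have := sum_equiv_disjointPairs (β := β) (hcI i) (hcI (i + k))
      (disjoint_cyclicInterval le_rfl (by omega) i) (fun A _ => f A)
    rw [card_disjointPairs, hcardZ, sum_disjointPairs k (fun A _ => f A)] at this
    have hE' : ∑ A ∈ Finset.powersetCard k (Finset.univ : Finset β),
        ∑ B ∈ Finset.powersetCard k Aᶜ, f A = (n - k).choose k * S.card := by
      rw [← Finset.sum_subset hSK]
      · rw [Finset.sum_congr rfl (g := fun _ => (((n - k).choose k : ℕ) : ℝ))]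
        · simp [mul_comm]
        · intro A hA
          rw [Finset.sum_const, Finset.card_powersetCard, Finset.card_compl, hS A hA, hβ]
          simp [hf, hA]
      · intro A _ hA
        simp [hf, hA]
    rw [hE'] at this
    rw [eq_div_iff hNpos.ne']
    have h2 : (∑ e, Y e i) * n.choose k * ((n - k).choose k : ℝ)
        = M * S.card * ((n - k).choose k : ℝ) := by
      rw [mul_assoc, hM]
      rw [show (Fintype.card (ZMod n ≃ β) : ℝ) * S.card * ((n - k).choose k : ℝ)
        = Fintype.card (ZMod n ≃ β) * (((n - k).choose k : ℝ) * S.card) by ring]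
      exact this
    exact mul_right_cancel₀ hDpos.ne' h2
  have hcyc := Finset.sum_le_sum fun e (_ : e ∈ (Finset.univ : Finset (ZMod n ≃ β))) =>
    cyclic_count hk hkn (Y e) (fun i => by
      simp only [hYdef, hf]; split_ifs <;> simp)
  rw [Finset.sum_sub_distrib, Finset.sum_add_distrib, ← Finset.mul_sum, ← Finset.mul_sum,
    Finset.sum_comm (t := Finset.Ico k (n - k + 1)),
    Finset.sum_congr rfl (fun d hd => by
      rw [Finset.sum_comm, Finset.sum_congr rfl fun i _ => hpairs i d (Finset.mem_Ico.1 hd).1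
        (by have := (Finset.mem_Ico.1 hd).2; omega)] :
      ∀ d ∈ Finset.Ico k (n - k + 1), ∑ e, ∑ i, Y e i * Y e (i + (d : ZMod n))
        = ∑ _i : ZMod n, M * E / (n.choose k * (n - k).choose k)),
    Finset.sum_comm (f := fun e i => Y e i * Y e (i + (k : ZMod n))),
    Finset.sum_congr rfl (fun i _ => hpairs i k le_rfl (by omega)),
    Finset.sum_comm (f := fun e i => Y e i), Finset.sum_congr rfl (fun i _ => hsingle i)] at hcyc
  simp only [Finset.sum_const, Finset.card_univ, hcardZ, nsmul_eq_mul, Nat.card_Ico] at hcyc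
  -- The circle inequality is quadratic in the number of intervals in `S`, so Cauchy–Schwarz bounds
  -- its second moment below by the known mean.
  have hCS := sq_sum_le_card_mul_sum_sq (s := (Finset.univ : Finset (ZMod n ≃ β)))
    (f := fun e => ∑ i, Y e i)
  rw [Finset.sum_comm (f := fun e i => Y e i), Finset.sum_congr rfl (fun i _ => hsingle i)] at hCS
  simp only [Finset.sum_const, Finset.card_univ, hcardZ, nsmul_eq_mul, sq, ← hM] at hCS
  have hcast : ((n - k + 1 - k : ℕ) : ℝ) = n - k + 1 - k := by
    rw [Nat.cast_sub (by omega), Nat.cast_add, Nat.cast_sub (by omega)]; simp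
  rw [hcast] at hcyc
  set Q := ∑ e, (∑ i, Y e i) * ∑ i, Y e i with hQ
  have hn0 : (0 : ℝ) < n := by exact_mod_cast Nat.pos_of_ne_zero (NeZero.ne n)
  set N : ℝ := ((n.choose k : ℕ) : ℝ) with hN
  set D : ℝ := (((n - k).choose k : ℕ) : ℝ) with hD
  set s : ℝ := ((S.card : ℕ) : ℝ) with hs
  -- The `n - 2k + 1` disjoint shifts and the `k - 1` extra copies of shift `k` have the same
  -- average, and together make the factor `n - k`.
  have h1 : n * (M * s / N) * (n * (M * s / N)) ≤ M * (k * (n * (M * s / N))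
      + n * (n - k) * (M * E / (N * D))) := by
    refine hCS.trans (mul_le_mul_of_nonneg_left ?_ hMpos.le)
    linarith
  have h2 : n * (M * s / N) * (n * (M * s / N)) * (N ^ 2 * D) = n * M ^ 2 * (n * s * s * D) := by
    field_simp
  have h3 : M * (k * (n * (M * s / N)) + n * (n - k) * (M * E / (N * D))) * (N ^ 2 * D)
      = n * M ^ 2 * (k * s * N * D + (n - k) * E * N) := by
    field_simp
  have h4 := mul_le_mul_of_nonneg_right h1 (by positivity : 0 ≤ N ^ 2 * D)
  rw [h2, h3] at h4
  have h5 := le_of_mul_le_mul_left h4 (by positivity)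
  linarith

/-- A large family of `k`-sets has a member that is disjoint from many others. -/
theorem exists_large_kneser_degree {k n : ℕ} (hβ : Fintype.card β = n) (hk : 1 ≤ k)
    (hkn : 2 * k ≤ n) {S : Finset (Finset β)} (hS : ∀ A ∈ S, A.card = k)
    (hlarge : (k : ℝ) / n * n.choose k < S.card) :
    ∃ A ∈ S, ((n - k).choose k : ℝ) * (S.card / n.choose k - k / n)
      ≤ (S.filter (Disjoint A)).card := by
  have hNpos : (0 : ℝ) < n.choose k := by exact_mod_cast Nat.choose_pos (by omega)
  have hDpos : (0 : ℝ) < (n - k).choose k := by exact_mod_cast Nat.choose_pos (by omega)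
  have hn0 : (0 : ℝ) < n := by exact_mod_cast (by omega : 0 < n)
  have hk0 : (0 : ℝ) < k := by exact_mod_cast hk
  have hkn' : (k : ℝ) < n := by exact_mod_cast (by omega : k < n)
  have hs : (0 : ℝ) < S.card := lt_of_le_of_lt (by positivity) hlarge
  by_contra! hcon
  have hne : S.Nonempty := Finset.card_pos.1 (by exact_mod_cast hs)
  have hlt := Finset.sum_lt_sum_of_nonempty hne hcon
  rw [Finset.sum_const, nsmul_eq_mul] at hlt
  have hsat := kneser_supersaturation hβ hk hkn hS
  set N : ℝ := ((n.choose k : ℕ) : ℝ) with hN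
  set D : ℝ := (((n - k).choose k : ℕ) : ℝ) with hD
  set s : ℝ := ((S.card : ℕ) : ℝ) with hs'
  have hpos : 0 < n * s - k * N := by
    rw [div_mul_eq_mul_div, div_lt_iff₀ hn0] at hlarge
    linarith
  have h1 : s * (D * (s / N - k / n)) * (N * n) = D * s * (n * s - k * N) := by
    field_simp
  have h2 := mul_lt_mul_of_pos_right hlt (by nlinarith : 0 < N * (n - k))
  -- Averaging the degrees would gain a further factor `n/(n-k)`; it is given up for a simpler
  -- bound.
  have h3 : D * s * (n * s - k * N) * (n - k) ≤ D * s * (n * s - k * N) * n :=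
    mul_le_mul_of_nonneg_left (by linarith) (by positivity)
  have h4 : s * (D * (s / N - k / n)) * (N * (n - k)) * n = D * s * (n * s - k * N) * (n - k) := by
    rw [← h1]; ring
  nlinarith

end Supersaturation

/-! ### Analysis of Shearer's function -/

section ShearerFunction

/-- Shearer's function `(d log d - d + 1) / (d - 1)^2`, written as an integral. -/
noncomputable def shearerFun (d : ℝ) : ℝ := ∫ x in (0 : ℝ)..1, (1 - x) / (1 + (d - 1) * x)

/-- The derivative of Shearer's function. -/
noncomputable def shearerSlope (d : ℝ) : ℝ :=
  -∫ x in (0 : ℝ)..1, (1 - x) * x / (1 + (d - 1) * x) ^ 2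

theorem shearer_denom_pos {d x : ℝ} (hd : 0 < d) (hx0 : 0 ≤ x) (hx1 : x ≤ 1) :
    0 < 1 + (d - 1) * x := by
  rcases hx1.lt_or_eq with h | h
  · nlinarith [mul_nonneg hd.le hx0]
  · rw [h]; linarith

theorem intervalIntegrable_shearerFun {d : ℝ} (hd : 0 < d) :
    IntervalIntegrable (fun x : ℝ => (1 - x) / (1 + (d - 1) * x)) volume 0 1 := by
  refine ContinuousOn.intervalIntegrable fun x hx => ContinuousAt.continuousWithinAt ?_
  rw [Set.uIcc_of_le zero_le_one] at hx
  have := (shearer_denom_pos hd hx.1 hx.2).ne'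
  fun_prop (disch := exact this)

theorem intervalIntegrable_shearerSlope {d : ℝ} (hd : 0 < d) :
    IntervalIntegrable (fun x : ℝ => (1 - x) * x / (1 + (d - 1) * x) ^ 2) volume 0 1 := by
  refine ContinuousOn.intervalIntegrable fun x hx => ContinuousAt.continuousWithinAt ?_
  rw [Set.uIcc_of_le zero_le_one] at hx
  have := pow_ne_zero 2 (shearer_denom_pos hd hx.1 hx.2).ne'
  fun_prop (disch := exact this)

theorem shearerSlope_nonpos (d : ℝ) : shearerSlope d ≤ 0 := by
  rw [shearerSlope, neg_nonpos]
  refine intervalIntegral.integral_nonneg zero_le_one fun x hx => ?_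
  exact div_nonneg (mul_nonneg (by linarith [hx.2]) hx.1) (sq_nonneg _)

/-- The differential equation satisfied by Shearer's function. -/
theorem shearer_ode {d : ℝ} (hd : 0 < d) :
    (d + 1) * shearerFun d = 1 + (d - d ^ 2) * shearerSlope d := by
  have hint := (intervalIntegrable_shearerFun hd).const_mul (d + 1)
  have hint' := (intervalIntegrable_shearerSlope hd).const_mul (d - d ^ 2)
  have key : ∫ x in (0 : ℝ)..1, ((d + 1) * ((1 - x) / (1 + (d - 1) * x))
      + (d - d ^ 2) * ((1 - x) * x / (1 + (d - 1) * x) ^ 2))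
      -- The combined integrand is the derivative in `x` of `-(1-x)²/(1+(d-1)x)`, which rises from
      -- `-1` to `0`; this produces the constant `1` of the equation.
      = (-((1 - 1) ^ 2 / (1 + (d - 1) * 1))) - (-((1 - 0) ^ 2 / (1 + (d - 1) * 0))) := by
    refine intervalIntegral.integral_eq_sub_of_hasDerivAt
      (f := fun x => -((1 - x) ^ 2 / (1 + (d - 1) * x))) (fun x hx => ?_) (hint.add hint')
    rw [Set.uIcc_of_le zero_le_one] at hx
    have hu := (shearer_denom_pos hd hx.1 hx.2).ne'
    have h1 : HasDerivAt (fun x : ℝ => (1 - x) ^ 2) (2 * (1 - x) * (-1)) x := by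
      refine (((hasDerivAt_id x).const_sub 1).pow 2).congr_deriv ?_
      simp
    have h2 : HasDerivAt (fun x : ℝ => 1 + (d - 1) * x) (d - 1) x := by
      have := ((hasDerivAt_id x).const_mul (d - 1)).const_add 1
      simpa using this
    refine (h1.div h2 hu).neg.congr_deriv ?_
    generalize hU : 1 + (d - 1) * x = U at hu
    field_simp
    rw [← hU]
    ring
  rw [intervalIntegral.integral_add hint hint', intervalIntegral.integral_const_mul,
    intervalIntegral.integral_const_mul] at key
  rw [shearerFun, shearerSlope]
  norm_num at key
  linarith

/-- Convexity of Shearer's function, as a tangent line inequality. -/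
theorem shearer_tangent {d e : ℝ} (hd : 0 < d) (he : 0 < e) :
    shearerFun d + shearerSlope d * (e - d) ≤ shearerFun e := by
  have hint := intervalIntegrable_shearerFun hd
  have hint' := (intervalIntegrable_shearerSlope hd).const_mul (d - e)
  have : shearerFun d + shearerSlope d * (e - d)
      = ∫ x in (0 : ℝ)..1, ((1 - x) / (1 + (d - 1) * x)
        + (d - e) * ((1 - x) * x / (1 + (d - 1) * x) ^ 2)) := by
    rw [intervalIntegral.integral_add hint hint', intervalIntegral.integral_const_mul, shearerFun,
      shearerSlope]
    ring
  rw [this, shearerFun]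
  refine intervalIntegral.integral_mono_on zero_le_one (hint.add hint')
    (intervalIntegrable_shearerFun he) fun x hx => ?_
  have hu := shearer_denom_pos hd hx.1 hx.2
  have hv := shearer_denom_pos he hx.1 hx.2
  have hsub : (1 - x) / (1 + (e - 1) * x) - ((1 - x) / (1 + (d - 1) * x)
      + (d - e) * ((1 - x) * x / (1 + (d - 1) * x) ^ 2))
      = (1 - x) * (((d - e) * x) ^ 2 / ((1 + (e - 1) * x) * (1 + (d - 1) * x) ^ 2)) := by
    generalize hU : 1 + (d - 1) * x = U at hu
    generalize hV : 1 + (e - 1) * x = V at hv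
    field_simp
    rw [← hU, ← hV]
    ring
  have : 0 ≤ (1 - x) * (((d - e) * x) ^ 2 / ((1 + (e - 1) * x) * (1 + (d - 1) * x) ^ 2)) :=
    mul_nonneg (by linarith [hx.2]) (by positivity)
  linarith

/-- This is the tangent inequality at the endpoint `0`, where the function would have value `1` but
the denominator vanishes at `x = 1`; the integrands are therefore compared directly. It settles
edgeless graphs. -/
theorem shearer_tangent_zero {d : ℝ} (hd : 0 < d) :
    shearerFun d + shearerSlope d * (0 - d) ≤ 1 := by
  have hint := intervalIntegrable_shearerFun hd
  have hint' := (intervalIntegrable_shearerSlope hd).const_mul d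
  have : shearerFun d + shearerSlope d * (0 - d)
      = ∫ x in (0 : ℝ)..1, ((1 - x) / (1 + (d - 1) * x)
        + d * ((1 - x) * x / (1 + (d - 1) * x) ^ 2)) := by
    rw [intervalIntegral.integral_add hint hint', intervalIntegral.integral_const_mul, shearerFun,
      shearerSlope]
    ring
  have h1 : (1 : ℝ) = ∫ _x in (0 : ℝ)..1, (1 : ℝ) := by simp
  rw [this]
  conv_rhs => rw [h1]
  refine intervalIntegral.integral_mono_on zero_le_one (hint.add hint')
    intervalIntegrable_const fun x hx => ?_
  have hu := shearer_denom_pos hd hx.1 hx.2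
  have hsub : 1 - ((1 - x) / (1 + (d - 1) * x) + d * ((1 - x) * x / (1 + (d - 1) * x) ^ 2))
      = (d * x) ^ 2 / (1 + (d - 1) * x) ^ 2 := by
    generalize hU : 1 + (d - 1) * x = U at hu
    field_simp
    rw [← hU]
    ring
  have : 0 ≤ (d * x) ^ 2 / (1 + (d - 1) * x) ^ 2 := by positivity
  linarith

/-- Enlarging the denominator to `1 + dx` gives an integrand exceeding `1/(1+dx) - 1/d`, whose
integral is elementary. -/
theorem log_sub_one_div_le_shearerFun {d : ℝ} (hd : 0 < d) :
    (Real.log d - 1) / d ≤ shearerFun d := by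
  have hpos : ∀ x ∈ Set.uIcc (0 : ℝ) 1, 0 < 1 + d * x := by
    intro x hx
    rw [Set.uIcc_of_le zero_le_one] at hx
    linarith [mul_nonneg hd.le hx.1]
  have hint : IntervalIntegrable (fun x : ℝ => 1 / (1 + d * x) - 1 / d) volume 0 1 := by
    refine ContinuousOn.intervalIntegrable fun x hx => ContinuousAt.continuousWithinAt ?_
    have := (hpos x hx).ne'
    fun_prop (disch := exact this)
  have key : ∫ x in (0 : ℝ)..1, (1 / (1 + d * x) - 1 / d)
      = (Real.log (1 + d * 1) / d - 1 / d * 1) - (Real.log (1 + d * 0) / d - 1 / d * 0) := by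
    refine intervalIntegral.integral_eq_sub_of_hasDerivAt
      (f := fun x => Real.log (1 + d * x) / d - 1 / d * x) (fun x hx => ?_) hint
    have h2 : HasDerivAt (fun x : ℝ => 1 + d * x) d x := by
      have := ((hasDerivAt_id x).const_mul d).const_add 1
      simpa using this
    have h3 := ((h2.log (hpos x hx).ne').div_const d).sub ((hasDerivAt_id x).const_mul (1 / d))
    refine h3.congr_deriv ?_
    have := (hpos x hx).ne'
    generalize 1 + d * x = U at this
    field_simp
  have hle : ∫ x in (0 : ℝ)..1, (1 / (1 + d * x) - 1 / d) ≤ shearerFun d := by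
    refine intervalIntegral.integral_mono_on zero_le_one hint
      (intervalIntegrable_shearerFun hd) fun x hx => ?_
    have hu := shearer_denom_pos hd hx.1 hx.2
    have hv := hpos x (by rwa [Set.uIcc_of_le zero_le_one])
    calc 1 / (1 + d * x) - 1 / d ≤ (1 - x) / (1 + d * x) := by
          rw [← sub_nonneg]
          have : (1 - x) / (1 + d * x) - (1 / (1 + d * x) - 1 / d) = 1 / (d * (1 + d * x)) := by
            generalize hU : 1 + d * x = U at hv
            field_simp
            rw [← hU]
            ring
          rw [this]
          positivity
      _ ≤ _ := div_le_div_of_nonneg_left (by linarith [hx.2]) hu (by nlinarith [hx.1])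
  refine le_trans ?_ hle
  rw [key]
  have hlog : Real.log d ≤ Real.log (1 + d * 1) := Real.log_le_log hd (by linarith)
  simp only [mul_zero, add_zero, Real.log_one, zero_div, sub_zero, mul_one] at hlog ⊢
  rw [← sub_div]
  gcongr

end ShearerFunction

/-! ### Independent sets in triangle-free graphs -/

section Shearer

variable {α : Type*}

open Classical in
/-- **Shearer's theorem** on independent sets in triangle-free graphs, stated through
tangent lines of Shearer's function. -/
theorem exists_indep_ge_shearer_tangent {adj : α → α → Prop} (hsymm : ∀ a b, adj a b → adj b a) :
    ∀ (m : ℕ) (S : Finset α), S.card ≤ m → (∀ a ∈ S, ¬ adj a a) →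
      (∀ a ∈ S, ∀ b ∈ S, ∀ c ∈ S, adj a b → adj b c → ¬ adj a c) → ∀ d : ℝ, 0 < d →
      ∃ I ⊆ S, IsIndep adj I ∧ S.card * shearerFun d
        + shearerSlope d * (∑ a ∈ S, ((S.filter (adj a)).card : ℝ) - S.card * d) ≤ I.card := by
  intro m
  induction m with
  | zero =>
    intro S hS _ _ d _
    rw [Nat.le_zero, Finset.card_eq_zero] at hS
    subst hS
    exact ⟨∅, by simp, by simp [IsIndep], by simp⟩
  | succ m ih =>
    intro S hS hirr htri e he
    set deg : α → ℝ := fun a => ((S.filter (adj a)).card : ℝ) with hdeg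
    set E := ∑ a ∈ S, deg a with hE
    have hdeg0 : ∀ a, 0 ≤ deg a := fun a => Nat.cast_nonneg _
    rcases (Finset.sum_nonneg fun a _ => hdeg0 a : 0 ≤ ∑ a ∈ S, deg a).eq_or_lt with h0 | hpos
    · refine ⟨S, subset_rfl, fun a ha b hb hab => ?_, ?_⟩
      · have := (Finset.sum_eq_zero_iff_of_nonneg fun a _ => hdeg0 a).1 h0.symm a ha
        simp only [hdeg, Nat.cast_eq_zero, Finset.card_eq_zero] at this
        exact Finset.eq_empty_iff_forall_notMem.1 this b (Finset.mem_filter.2 ⟨hb, hab⟩)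
      · rw [hE, ← h0]
        have := mul_le_mul_of_nonneg_left (shearer_tangent_zero he) (Nat.cast_nonneg (α := ℝ) S.card)
        linarith
    have hne : S.Nonempty := by
      rw [Finset.nonempty_iff_ne_empty]
      rintro rfl
      simp at hpos
    set n : ℝ := ((S.card : ℕ) : ℝ) with hn
    have hn0 : 0 < n := by rw [hn]; exact_mod_cast hne.card_pos
    -- The claim is proved at every tangent point `e`, but the induction hypothesis is used at the
    -- average degree `d` of `S`. With `d` fixed the bound is linear in the vertex and edge counts,
    -- so deleting vertices changes it by an explicit amount.
    set d := E / n with hd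
    have hd0 : 0 < d := div_pos hpos hn0
    have hEd : E = n * d := by rw [hd]; field_simp
    set s : α → ℝ := fun v => ∑ w ∈ S.filter (adj v), deg w with hs
    have hssum : ∑ v ∈ S, s v = ∑ w ∈ S, deg w ^ 2 := by
      simp only [hs, Finset.sum_filter]
      rw [Finset.sum_comm]
      refine Finset.sum_congr rfl fun w _ => ?_
      rw [← Finset.sum_filter, Finset.sum_const, nsmul_eq_mul, sq]
      congr 3
      ext v
      simp only [Finset.mem_filter]
      exact and_congr_right fun _ => ⟨hsymm _ _, hsymm _ _⟩
    have hsq : n * d ^ 2 ≤ ∑ w ∈ S, deg w ^ 2 := by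
      have := sq_sum_le_card_mul_sum_sq (s := S) (f := deg)
      rw [← hE, hEd, ← hn] at this
      have h2 : n * (n * d ^ 2) ≤ n * ∑ w ∈ S, deg w ^ 2 := by linarith
      exact le_of_mul_le_mul_left h2 hn0
    have hslope := shearerSlope_nonpos d
    -- This is the condition that removing `v` with its neighbours lowers the bound at `d` by at
    -- most `1`, the gain from putting `v` into the independent set. It holds on average: the slope
    -- is nonpositive, `∑ deg² ≥ n d²`, and equality would be the differential equation.
    obtain ⟨v, hvS, hv⟩ : ∃ v ∈ S, (deg v + 1) * shearerFun d
        ≤ 1 + (d * deg v + d - 2 * s v) * shearerSlope d := by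
      by_contra! hcon
      have hlt := Finset.sum_lt_sum_of_nonempty hne hcon
      rw [← Finset.sum_mul, Finset.sum_add_distrib, Finset.sum_add_distrib, ← Finset.sum_mul,
        Finset.sum_sub_distrib, Finset.sum_add_distrib, ← Finset.mul_sum, ← Finset.mul_sum, hssum,
        ← hE, hEd, Finset.sum_const, Finset.sum_const, nsmul_eq_mul, nsmul_eq_mul, ← hn] at hlt
      have h2 := congrArg (n * ·) (shearer_ode hd0)
      nlinarith [mul_nonneg_of_nonpos_of_nonpos hslope (sub_nonpos.2 hsq)]
    set Nv := S.filter (adj v) with hNv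
    have hvNv : v ∉ Nv := fun h => hirr v hvS (Finset.mem_filter.1 h).2
    set S' := S \ insert v Nv with hS'
    have hsubS : insert v Nv ⊆ S := Finset.insert_subset hvS (Finset.filter_subset _ _)
    have hcard : S'.card + (Nv.card + 1) = S.card := by
      rw [hS', ← Finset.card_insert_of_notMem hvNv, Finset.card_sdiff_add_card_eq_card hsubS]
    have hcardR : (S'.card : ℝ) = n - (deg v + 1) := by
      have : (S'.card : ℝ) + (Nv.card + 1) = n := by rw [hn]; exact_mod_cast hcard
      simp only [hdeg]
      linarith
    -- Triangle-freeness means that no edge has both ends in the neighbourhood of `v`. Hence the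
    -- edges destroyed are those with exactly one end there, including the edges at `v`, and in
    -- ordered pairs there are `2 s v` of them.
    have hedges : ∑ a ∈ S', ((S'.filter (adj a)).card : ℝ) = E - 2 * s v := by
      have hmem : ∀ a, a ∈ S' ↔ a ∈ S ∧ a ≠ v ∧ ¬ adj v a := by
        intro a
        simp only [hS', hNv, Finset.mem_sdiff, Finset.mem_insert, Finset.mem_filter]
        tauto
      have hsub' : S' ⊆ S := Finset.sdiff_subset
      have e1 : ∑ a ∈ S', ((S'.filter (adj a)).card : ℝ)
          = ∑ a ∈ S, ∑ b ∈ S, if a ∈ S' ∧ b ∈ S' ∧ adj a b then (1 : ℝ) else 0 := by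
        rw [← Finset.sum_subset hsub' (fun a _ ha => by simp [ha])]
        refine Finset.sum_congr rfl fun a ha => ?_
        rw [← Finset.sum_subset hsub' (fun b _ hb => by simp [hb]), Finset.card_filter]
        push_cast
        exact Finset.sum_congr rfl fun b hb => by simp [ha, hb]
      have e2 : E = ∑ a ∈ S, ∑ b ∈ S, if adj a b then (1 : ℝ) else 0 := by
        rw [hE]
        refine Finset.sum_congr rfl fun a _ => ?_
        simp only [hdeg, Finset.card_filter]
        push_cast
        rfl
      have e3 : s v = ∑ a ∈ S, ∑ b ∈ S, if adj v a ∧ adj a b then (1 : ℝ) else 0 := by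
        simp only [hs, Finset.sum_filter]
        refine Finset.sum_congr rfl fun a _ => ?_
        by_cases h : adj v a
        · simp only [h, if_true, true_and, hdeg, Finset.card_filter]
          push_cast
          rfl
        · simp [h]
      have e4 : s v = ∑ a ∈ S, ∑ b ∈ S, if adj v b ∧ adj a b then (1 : ℝ) else 0 := by
        rw [e3, Finset.sum_comm]
        refine Finset.sum_congr rfl fun a _ => Finset.sum_congr rfl fun b _ => ?_
        exact if_congr (and_congr_right fun _ => ⟨hsymm _ _, hsymm _ _⟩) rfl rfl
      have : E - 2 * s v = E - s v - s v := by ring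
      rw [this]
      nth_rewrite 2 [e4]
      rw [e1, e2, e3, ← Finset.sum_sub_distrib, ← Finset.sum_sub_distrib]
      refine Finset.sum_congr rfl fun a ha => ?_
      rw [← Finset.sum_sub_distrib, ← Finset.sum_sub_distrib]
      refine Finset.sum_congr rfl fun b hb => ?_
      simp only [hmem]
      by_cases hab : adj a b
      · by_cases hva : adj v a
        · have hvb : ¬ adj v b := htri v hvS a ha b hb hva hab
          simp [hab, hva, hvb]
        · by_cases hvb : adj v b
          · simp [hab, hva, hvb]
          · have hav : a ≠ v := by rintro rfl; exact hvb hab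
            have hbv : b ≠ v := by rintro rfl; exact hva (hsymm _ _ hab)
            simp [hab, hva, hvb, hav, hbv, ha, hb]
      · simp [hab]
    have hsub' : S' ⊆ S := Finset.sdiff_subset
    obtain ⟨I, hIS, hI, hIcard⟩ := ih S' (by omega) (fun a ha => hirr a (hsub' ha))
      (fun a ha b hb c hc => htri a (hsub' ha) b (hsub' hb) c (hsub' hc)) d hd0
    have hvI : v ∉ I := fun h => by
      have := hIS h
      simp [hS'] at this
    have hvadj : ∀ b ∈ I, ¬ adj v b := fun b hb h => by
      have := hIS hb
      simp only [hS', Finset.mem_sdiff, Finset.mem_insert, hNv, Finset.mem_filter, not_or,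
        not_and] at this
      exact this.2.2 this.1 h
    refine ⟨insert v I, Finset.insert_subset hvS (hIS.trans hsub'), ?_, ?_⟩
    · intro a ha b hb hab
      rcases Finset.mem_insert.1 ha with rfl | ha' <;> rcases Finset.mem_insert.1 hb with rfl | hb'
      · exact hirr _ hvS hab
      · exact hvadj b hb' hab
      · exact hvadj a ha' (hsymm _ _ hab)
      · exact hI a ha' b hb' hab
    · rw [Finset.card_insert_of_notMem hvI]
      rw [hcardR, hedges] at hIcard
      have h1 : n * shearerFun d ≤ I.card + 1 := by
        rw [hEd] at hIcard
        linarith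
      -- Convexity passes from the tangent point `d` to the arbitrary point `e`.
      have h2 := mul_le_mul_of_nonneg_left (shearer_tangent he hd0) hn0.le
      push_cast
      rw [hEd]
      linarith

/-- A triangle-free graph with maximum degree at most `d` has an independent set of proportion
at least `(log d - 1) / d`. -/
theorem exists_indep_ge_of_triangleFree {adj : α → α → Prop} (hsymm : ∀ a b, adj a b → adj b a)
    {S : Finset α} (hirr : ∀ a ∈ S, ¬ adj a a)
    (htri : ∀ a ∈ S, ∀ b ∈ S, ∀ c ∈ S, adj a b → adj b c → ¬ adj a c) {d : ℝ} (hd : 0 < d)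
    (hdeg : ∀ a ∈ S, ∀ B ⊆ S, (∀ b ∈ B, adj a b) → (B.card : ℝ) ≤ d) :
    ∃ I ⊆ S, IsIndep adj I ∧ S.card * ((Real.log d - 1) / d) ≤ I.card := by
  classical
  obtain ⟨I, hIS, hI, hcard⟩ :=
    exists_indep_ge_shearer_tangent hsymm S.card S le_rfl hirr htri d hd
  refine ⟨I, hIS, hI, le_trans ?_ hcard⟩
  have h1 : ∑ a ∈ S, ((S.filter (adj a)).card : ℝ) ≤ S.card * d := by
    refine (Finset.sum_le_sum fun a ha => hdeg a ha _ (Finset.filter_subset _ _)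
      fun b hb => (Finset.mem_filter.1 hb).2).trans_eq ?_
    rw [Finset.sum_const, nsmul_eq_mul]
  have h2 := mul_nonneg_of_nonpos_of_nonpos (shearerSlope_nonpos d) (sub_nonpos.2 h1)
  have h3 := mul_le_mul_of_nonneg_left (log_sub_one_div_le_shearerFun hd)
    (Nat.cast_nonneg (α := ℝ) S.card)
  linarith

end Shearer

/-! ### Intersecting families as independent sets of the Kneser graph -/

section MaxIntersecting

variable {n : ℕ}

theorem isIndep_disjoint_iff {F : Finset (Finset (Fin n))} :
    IsIndep Disjoint F ↔ ∀ A ∈ F, ∀ B ∈ F, (A ∩ B).Nonempty := by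
  simp only [IsIndep, Finset.not_disjoint_iff_nonempty_inter]

theorem card_le_maxIntersecting {H : Set (Finset (Fin n))} {F : Finset (Finset (Fin n))}
    (hFH : (F : Set (Finset (Fin n))) ⊆ H) (hF : IsIndep Disjoint F) :
    F.card ≤ maxIntersecting H := by
  classical
  exact Finset.le_sup (f := Finset.card)
    (Finset.mem_filter.2 ⟨Finset.mem_univ F, hFH, isIndep_disjoint_iff.1 hF⟩)

theorem exists_card_eq_maxIntersecting (H : Set (Finset (Fin n))) :
    ∃ F : Finset (Finset (Fin n)), (F : Set (Finset (Fin n))) ⊆ H ∧ IsIndep Disjoint F ∧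
      F.card = maxIntersecting H := by
  classical
  obtain ⟨F, hF, h⟩ := Finset.exists_mem_eq_sup
    (Finset.univ.filter fun F : Finset (Finset (Fin n)) =>
      (F : Set (Finset (Fin n))) ⊆ H ∧ ∀ A ∈ F, ∀ B ∈ F, (A ∩ B).Nonempty)
    ⟨∅, by simp⟩ Finset.card
  have h2 := (Finset.mem_filter.1 hF).2
  refine ⟨F, h2.1, isIndep_disjoint_iff.2 h2.2, ?_⟩
  rw [← h, maxIntersecting]

end MaxIntersecting

/-! ### Reduction to small failure probabilities -/

section AsymptoticallyAlmostSurely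

variable {k : ℕ → ℕ} {p : ℕ → unitInterval}

instance (n k : ℕ) (p : unitInterval) : IsProbabilityMeasure (randomHypergraph n k p) := by
  unfold randomHypergraph; infer_instance

theorem holdsAAS_of_forall_pos {P : ∀ n : ℕ, Set (Finset (Fin n)) → Prop}
    (h : ∀ η : ℝ, 0 < η → ∀ᶠ n in atTop,
      (randomHypergraph n (k n) (p n)).real {H | ¬ P n H} ≤ η) : HoldsAAS k p P := by
  have h0 : Tendsto (fun n => (randomHypergraph n (k n) (p n)).real {H | ¬ P n H}) atTop (𝓝 0) := by
    rw [Metric.tendsto_nhds]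
    intro η hη
    filter_upwards [h (η / 2) (by linarith)] with n hn
    rw [Real.dist_eq, sub_zero, abs_of_nonneg measureReal_nonneg]
    linarith
  have h1 : Tendsto (fun n => ENNReal.ofReal
      (1 - (randomHypergraph n (k n) (p n)).real {H | ¬ P n H})) atTop (𝓝 1) := by
    have := ENNReal.tendsto_ofReal (h0.const_sub 1)
    simpa using this
  refine h1.congr fun n => ?_
  have := probReal_compl_eq_one_sub (μ := randomHypergraph n (k n) (p n))
    (s := {H | ¬ P n H}) MeasurableSet.of_discrete
  rw [← this, measureReal_def, ENNReal.ofReal_toReal (measure_ne_top _ _)]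
  congr 1
  ext H
  simp

theorem HoldsAAS.and {P Q : ∀ n : ℕ, Set (Finset (Fin n)) → Prop}
    (hP : ∀ η : ℝ, 0 < η → ∀ᶠ n in atTop,
      (randomHypergraph n (k n) (p n)).real {H | ¬ P n H} ≤ η)
    (hQ : ∀ η : ℝ, 0 < η → ∀ᶠ n in atTop,
      (randomHypergraph n (k n) (p n)).real {H | ¬ Q n H} ≤ η) :
    HoldsAAS k p fun n H => P n H ∧ Q n H := by
  refine holdsAAS_of_forall_pos fun η hη => ?_
  filter_upwards [hP (η / 2) (by linarith), hQ (η / 2) (by linarith)] with n h1 h2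
  refine (measureReal_mono (s₂ := {H | ¬ P n H} ∪ {H | ¬ Q n H}) fun H hH => ?_).trans
    ((measureReal_union_le _ _).trans (by linarith))
  exact not_and_or.1 hH

end AsymptoticallyAlmostSurely

/-! ### Bounds for fixed `n`: edge counts, stars, deletion -/

section FiniteBounds

variable {n k : ℕ} (p : unitInterval)

theorem randomHypergraph_eq : randomHypergraph n k p
    = setBernoulli ((Finset.powersetCard k Finset.univ : Finset (Finset (Fin n))) :
        Set (Finset (Fin n))) p := by
  rw [randomHypergraph]
  congr 1
  ext e
  simp

/-- Relative concentration of the number of edges in a prescribed family of `k`-sets. -/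
theorem randomHypergraph_real_hitCount {U : Finset (Finset (Fin n))} (hU : ∀ A ∈ U, A.card = k)
    {m : ℝ} (hm : (U.card : ℝ) = m) (hpos : 0 < (p : ℝ) * m) {δ : ℝ} (hδ : 0 < δ) :
    (randomHypergraph n k p).real {H | δ * (p * m) ≤ |(hitCount U H : ℝ) - p * m|}
      ≤ 1 / (δ ^ 2 * (p * m)) := by
  have := measureReal_abs_hitCount_sub_ge (M := {e : Finset (Fin n) | e.card = k}) p
    (U := U) (fun A hA => hU A hA) (s := δ * (p * m)) (by positivity)
  rw [hm, mul_comm m] at this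
  refine this.trans (le_of_eq ?_)
  generalize (p : ℝ) * m = x at *
  field_simp

theorem maxIntersecting_le_hitCount_ae : ∀ᵐ H ∂(randomHypergraph n k p),
    maxIntersecting H ≤ hitCount (Finset.powersetCard k Finset.univ) H := by
  classical
  filter_upwards [setBernoulli_ae_subset (u := {e : Finset (Fin n) | e.card = k}) (p := p)]
    with H hH
  obtain ⟨F, hFH, _, hF⟩ := exists_card_eq_maxIntersecting H
  rw [← hF]
  refine Finset.card_le_card fun A hA => ?_
  exact Finset.mem_filter.2 ⟨Finset.mem_powersetCard_univ.2 (hH (hFH hA)), hFH hA⟩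

/-- The number of edges bounds the size of intersecting subfamilies from above. -/
theorem randomHypergraph_real_maxIntersecting_gt (hpos : 0 < (p : ℝ) * n.choose k) {δ : ℝ}
    (hδ : 0 < δ) :
    (randomHypergraph n k p).real
      {H | ¬ ((maxIntersecting H : ℝ) ≤ (1 + δ) * (p * n.choose k))}
      ≤ 1 / (δ ^ 2 * (p * n.choose k)) := by
  refine le_trans ?_ (randomHypergraph_real_hitCount p
    (U := (Finset.powersetCard k Finset.univ : Finset (Finset (Fin n)))) (k := k)
    (fun A hA => Finset.mem_powersetCard_univ.1 hA) (m := n.choose k) (by simp) hpos hδ)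
  refine ENNReal.toReal_mono (measure_ne_top _ _) (measure_mono_ae ?_)
  filter_upwards [maxIntersecting_le_hitCount_ae (n := n) (k := k) p] with H hH h
  have h1 : (maxIntersecting H : ℝ) ≤ hitCount (Finset.powersetCard k Finset.univ) H := by
    exact_mod_cast hH
  have h2 : ¬ ((maxIntersecting H : ℝ) ≤ (1 + δ) * (p * n.choose k)) := h
  show δ * (p * n.choose k) ≤ |(hitCount (Finset.powersetCard k Finset.univ) H : ℝ) - _|
  rw [not_le] at h2
  exact le_trans (by linarith) (le_abs_self _)

/-- Stars give large intersecting families. -/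
theorem randomHypergraph_real_maxIntersecting_lt_star (hk : 1 ≤ k) (hkn : k ≤ n)
    (hpos : 0 < (p : ℝ) * ((k : ℝ) / n * n.choose k)) {δ : ℝ} (hδ : 0 < δ) :
    (randomHypergraph n k p).real
      {H | ¬ ((1 - δ) * (p * ((k : ℝ) / n * n.choose k)) ≤ (maxIntersecting H : ℝ))}
      ≤ 1 / (δ ^ 2 * (p * ((k : ℝ) / n * n.choose k))) := by
  classical
  obtain ⟨m, rfl⟩ : ∃ m, n = m + 1 := ⟨n - 1, by omega⟩
  obtain ⟨j, rfl⟩ : ∃ j, k = j + 1 := ⟨k - 1, by omega⟩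
  set U : Finset (Finset (Fin (m + 1))) :=
    (Finset.powersetCard j ({0}ᶜ : Finset (Fin (m + 1)))).image (insert 0) with hU
  have hmem : ∀ A ∈ U, A.card = j + 1 ∧ 0 ∈ A := by
    intro A hA
    obtain ⟨B, hB, rfl⟩ := Finset.mem_image.1 hA
    rw [Finset.mem_powersetCard] at hB
    refine ⟨?_, Finset.mem_insert_self _ _⟩
    rw [Finset.card_insert_of_notMem, hB.2]
    intro h0
    simpa using hB.1 h0
  have hcard : (U.card : ℝ) = ((j + 1 : ℕ) : ℝ) / (m + 1 : ℕ) * (m + 1).choose (j + 1) := by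
    rw [hU, Finset.card_image_of_injOn, Finset.card_powersetCard, Finset.card_compl]
    · have := Nat.add_one_mul_choose_eq m j
      have h2 : ((m + 1 : ℕ) : ℝ) * m.choose j = (m + 1).choose (j + 1) * (j + 1 : ℕ) := by
        exact_mod_cast this
      have hm : ((m + 1 : ℕ) : ℝ) ≠ 0 := by positivity
      simp only [Fintype.card_fin, Finset.card_singleton, Nat.add_sub_cancel]
      field_simp
      linarith
    · intro A hA B hB h
      have hA' : (0 : Fin (m + 1)) ∉ A := fun h0 => by
        simpa using (Finset.mem_powersetCard.1 hA).1 h0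
      have hB' : (0 : Fin (m + 1)) ∉ B := fun h0 => by
        simpa using (Finset.mem_powersetCard.1 hB).1 h0
      have := congrArg (Finset.erase · 0) h
      simpa [Finset.erase_insert hA', Finset.erase_insert hB'] using this
  refine le_trans ?_ (randomHypergraph_real_hitCount p (U := U) (k := j + 1)
    (fun A hA => (hmem A hA).1) hcard hpos hδ)
  refine measureReal_mono fun H hH => ?_
  have h1 : hitCount U H ≤ maxIntersecting H := by
    refine card_le_maxIntersecting (fun A hA => (Finset.mem_filter.1 hA).2) ?_
    intro A hA B hB
    rw [Finset.not_disjoint_iff]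
    exact ⟨0, (hmem A (Finset.mem_filter.1 hA).1).2, (hmem B (Finset.mem_filter.1 hB).1).2⟩
  have h2 : (hitCount U H : ℝ) ≤ maxIntersecting H := by exact_mod_cast h1
  have h3 : ¬ (_ ≤ _) := hH
  rw [not_le] at h3
  show δ * (p * (((j + 1 : ℕ) : ℝ) / (m + 1 : ℕ) * (m + 1).choose (j + 1)))
    ≤ |(hitCount U H : ℝ) - p * (((j + 1 : ℕ) : ℝ) / (m + 1 : ℕ) * (m + 1).choose (j + 1))|
  exact le_trans (by linarith) (neg_le_abs _)

/-- The number of ordered pairs of disjoint `k`-sets in `H`. -/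
noncomputable def edgeCount (n k : ℕ) (H : Set (Finset (Fin n))) : ℝ :=
  ∑ A ∈ Finset.powersetCard k Finset.univ, ∑ B ∈ Finset.powersetCard k Aᶜ,
    subsetIndicator {A, B} H

/-- The number of ordered triples of pairwise disjoint `k`-sets in `H`. -/
noncomputable def triangleCount (n k : ℕ) (H : Set (Finset (Fin n))) : ℝ :=
  ∑ A ∈ Finset.powersetCard k Finset.univ, ∑ B ∈ Finset.powersetCard k Aᶜ,
    ∑ C ∈ Finset.powersetCard k (A ∪ B)ᶜ, subsetIndicator {A, B, C} H

/-- Only the empty set is disjoint from itself. For `k ≥ 1` this makes the sets in a disjoint pair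
or triple distinct, so that their joint probability is exactly `p²` or `p³`. -/
theorem ne_of_disjoint_of_card {A B : Finset (Fin n)} (hk : 1 ≤ k) (hA : A.card = k)
    (h : Disjoint A B) : A ≠ B := by
  rintro rfl
  rw [disjoint_self, Finset.bot_eq_empty] at h
  simp [h] at hA
  omega

theorem integral_edgeCount (hk : 1 ≤ k) :
    ∫ H, edgeCount n k H ∂(randomHypergraph n k p)
      = n.choose k * ((n - k).choose k * (p : ℝ) ^ 2) := by
  unfold edgeCount
  rw [integral_finsetSum _ fun _ _ => Integrable.of_finite,
    Finset.sum_congr rfl (g := fun _ => ((n - k).choose k : ℝ) * (p : ℝ) ^ 2)]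
  · simp
  intro A hA
  have hA := Finset.mem_powersetCard_univ.1 hA
  rw [integral_finsetSum _ fun _ _ => Integrable.of_finite,
    Finset.sum_congr rfl (g := fun _ => (p : ℝ) ^ 2)]
  · simp [Finset.card_compl, hA]
  intro B hB
  obtain ⟨hB, hBk⟩ := Finset.mem_powersetCard.1 hB
  have hAB := ne_of_disjoint_of_card hk hA (Finset.subset_compl_iff_disjoint_left.1 hB)
  rw [randomHypergraph, integral_subsetIndicator, Finset.card_pair hAB]
  intro x hx
  simp only [Finset.coe_insert, Finset.coe_singleton, Set.mem_insert_iff,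
    Set.mem_singleton_iff] at hx
  rcases hx with rfl | rfl <;> assumption

theorem integral_triangleCount (hk : 1 ≤ k) :
    ∫ H, triangleCount n k H ∂(randomHypergraph n k p)
      = n.choose k * ((n - k).choose k * ((n - 2 * k).choose k * (p : ℝ) ^ 3)) := by
  unfold triangleCount
  rw [integral_finsetSum _ fun _ _ => Integrable.of_finite, Finset.sum_congr rfl
    (g := fun _ => ((n - k).choose k : ℝ) * ((n - 2 * k).choose k * (p : ℝ) ^ 3))]
  · simp
  intro A hA
  have hA := Finset.mem_powersetCard_univ.1 hA
  rw [integral_finsetSum _ fun _ _ => Integrable.of_finite, Finset.sum_congr rfl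
    (g := fun _ => ((n - 2 * k).choose k : ℝ) * (p : ℝ) ^ 3)]
  · simp [Finset.card_compl, hA]
  intro B hB
  obtain ⟨hB, hBk⟩ := Finset.mem_powersetCard.1 hB
  rw [Finset.subset_compl_iff_disjoint_left] at hB
  have hAB := ne_of_disjoint_of_card hk hA hB
  rw [integral_finsetSum _ fun _ _ => Integrable.of_finite,
    Finset.sum_congr rfl (g := fun _ => (p : ℝ) ^ 3)]
  · rw [Finset.sum_const, Finset.card_powersetCard, Finset.card_compl,
      Finset.card_union_of_disjoint hB, hA, hBk, Fintype.card_fin, ← two_mul, nsmul_eq_mul]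
  intro C hC
  obtain ⟨hC, hCk⟩ := Finset.mem_powersetCard.1 hC
  rw [Finset.subset_compl_iff_disjoint_left, Finset.disjoint_union_left] at hC
  have hAC := ne_of_disjoint_of_card hk hA hC.1
  have hBC := ne_of_disjoint_of_card hk hBk hC.2
  rw [randomHypergraph, integral_subsetIndicator, Finset.card_eq_three.2 ⟨A, B, C, hAB, hAC, hBC, rfl⟩]
  intro x hx
  simp only [Finset.coe_insert, Finset.coe_singleton, Set.mem_insert_iff,
    Set.mem_singleton_iff] at hx
  rcases hx with rfl | rfl | rfl <;> assumption

open Classical in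
/-- The members of `H` that are disjoint from another member of `H` are at most as many as the
pairs. -/
theorem card_filter_edge_le (H : Set (Finset (Fin n))) :
    (((Finset.powersetCard k Finset.univ).filter fun A => A ∈ H ∧
      ∃ B ∈ H, B.card = k ∧ Disjoint A B).card : ℝ) ≤ edgeCount n k H := by
  rw [Finset.card_filter]
  push_cast
  refine Finset.sum_le_sum fun A hA => ?_
  split_ifs with h
  · obtain ⟨hAH, B, hBH, hBk, hAB⟩ := h
    refine le_trans (le_of_eq ?_) (Finset.single_le_sum
      (fun _ _ => subsetIndicator_nonneg _ _) (Finset.mem_powersetCard.2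
      ⟨Finset.subset_compl_iff_disjoint_left.2 hAB, hBk⟩))
    rw [subsetIndicator_of_subset]
    simp [Set.insert_subset_iff, hAH, hBH]
  · exact Finset.sum_nonneg fun _ _ => subsetIndicator_nonneg _ _

open Classical in
/-- The members of `H` that lie in a triangle of the Kneser graph are at most as many as the
triangles. -/
theorem card_filter_triangle_le (H : Set (Finset (Fin n))) :
    (((Finset.powersetCard k Finset.univ).filter fun A => A ∈ H ∧ ∃ B ∈ H, ∃ C ∈ H,
      B.card = k ∧ C.card = k ∧ Disjoint A B ∧ Disjoint A C ∧ Disjoint B C).card : ℝ)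
      ≤ triangleCount n k H := by
  rw [Finset.card_filter]
  push_cast
  refine Finset.sum_le_sum fun A hA => ?_
  split_ifs with h
  · obtain ⟨hAH, B, hBH, C, hCH, hBk, hCk, hAB, hAC, hBC⟩ := h
    refine le_trans ?_ (Finset.single_le_sum
      (fun _ _ => Finset.sum_nonneg fun _ _ => subsetIndicator_nonneg _ _)
      (Finset.mem_powersetCard.2 ⟨Finset.subset_compl_iff_disjoint_left.2 hAB, hBk⟩))
    refine le_trans (le_of_eq ?_) (Finset.single_le_sum
      (fun _ _ => subsetIndicator_nonneg _ _) (Finset.mem_powersetCard.2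
      ⟨Finset.subset_compl_iff_disjoint_left.2 (Finset.disjoint_union_left.2 ⟨hAC, hBC⟩), hCk⟩))
    rw [subsetIndicator_of_subset]
    simp [Set.insert_subset_iff, hAH, hBH, hCH]
  · exact Finset.sum_nonneg fun _ _ => Finset.sum_nonneg fun _ _ => subsetIndicator_nonneg _ _

open Classical in
/-- Deleting one end of every disjoint pair leaves an intersecting family. -/
theorem randomHypergraph_real_maxIntersecting_lt_deletion (hk : 1 ≤ k)
    (hpos : 0 < (p : ℝ) * n.choose k) {δ : ℝ} (hδ : 0 < δ) :
    (randomHypergraph n k p).real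
      {H | ¬ ((1 - 2 * δ) * (p * n.choose k) ≤ (maxIntersecting H : ℝ))}
      ≤ 1 / (δ ^ 2 * (p * n.choose k)) + p * (n - k).choose k / δ := by
  set K := (Finset.powersetCard k Finset.univ : Finset (Finset (Fin n))) with hK
  have hg0 : ∀ H, 0 ≤ edgeCount n k H := fun H => Finset.sum_nonneg fun A _ =>
    Finset.sum_nonneg fun B _ => subsetIndicator_nonneg _ _
  have hp1 := randomHypergraph_real_hitCount p (k := k) (U := K)
      (fun A hA => Finset.mem_powersetCard_univ.1 hA) (m := n.choose k) (by simp [hK]) hpos hδ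
  have hp2 := measureReal_le_integral_div (randomHypergraph n k p) hg0 (mul_pos hδ hpos)
    (E := {H | δ * (p * n.choose k) ≤ edgeCount n k H}) (fun H h => h)
  rw [integral_edgeCount p hk] at hp2
  have hsimp : n.choose k * ((n - k).choose k * (p : ℝ) ^ 2) / (δ * (p * n.choose k))
      = p * (n - k).choose k / δ := by
    have h1 : (p : ℝ) ≠ 0 := left_ne_zero_of_mul hpos.ne'
    have h2 : (n.choose k : ℝ) ≠ 0 := right_ne_zero_of_mul hpos.ne'
    field_simp
  rw [hsimp] at hp2
  refine le_trans (measureReal_mono fun H hH => ?_)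
    ((measureReal_union_le _ _).trans (add_le_add hp1 hp2))
  by_contra hcon
  simp only [Set.mem_union, Set.mem_ofPred_eq, not_or, not_le] at hcon hH
  obtain ⟨h1, h2⟩ := hcon
  have h3 := card_filter_edge_le (k := k) H
  set F := (K.filter (· ∈ H)).filter fun A => ¬ ∃ B ∈ H, B.card = k ∧ Disjoint A B with hF
  have hcard := Finset.card_filter_add_card_filter_not (s := K.filter (· ∈ H))
    (fun A => ∃ B ∈ H, B.card = k ∧ Disjoint A B)
  rw [Finset.filter_filter] at hcard
  have h4 : F.card ≤ maxIntersecting H := by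
    refine card_le_maxIntersecting (fun A hA =>
      (Finset.mem_filter.1 (Finset.mem_filter.1 hA).1).2) fun A hA B hB hAB => ?_
    have hB' := Finset.mem_filter.1 (Finset.mem_filter.1 hB).1
    exact (Finset.mem_filter.1 hA).2 ⟨B, hB'.2, Finset.mem_powersetCard_univ.1 hB'.1, hAB⟩
  have h5 : ((K.filter fun A => A ∈ H ∧ ∃ B ∈ H, B.card = k ∧ Disjoint A B).card : ℝ) + F.card
      = hitCount K H := by exact_mod_cast hcard
  have h6 : (F.card : ℝ) ≤ maxIntersecting H := by exact_mod_cast h4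
  have h7 := neg_le_abs ((hitCount K H : ℝ) - p * n.choose k)
  linarith

end FiniteBounds

/-! ### Bounds for fixed `n`: Shearer's theorem and containers in the random graph -/

section FiniteBounds

variable {n k : ℕ} (p : unitInterval)

/-- The sum over the edges `A ∈ H` of the squared deviation of the degree of `A`. -/
noncomputable def degreeDeviation (n k : ℕ) (p : ℝ) (H : Set (Finset (Fin n))) : ℝ :=
  ∑ A ∈ Finset.powersetCard k Finset.univ, subsetIndicator {A} H *
    ((hitCount (Finset.powersetCard k Aᶜ) H : ℝ) - (Finset.powersetCard k Aᶜ).card * p) ^ 2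

theorem degreeDeviation_nonneg (n k : ℕ) (p : ℝ) (H : Set (Finset (Fin n))) :
    0 ≤ degreeDeviation n k p H :=
  Finset.sum_nonneg fun _ _ => mul_nonneg (subsetIndicator_nonneg _ _) (sq_nonneg _)

/-- As `A` is not disjoint from itself, its degree is independent of the event `A ∈ H`; each term is
`p` times the variance of a binomial variable with `D` trials. -/
theorem integral_degreeDeviation_le (hk : 1 ≤ k) :
    ∫ H, degreeDeviation n k p H ∂(randomHypergraph n k p)
      ≤ n.choose k * (p * ((n - k).choose k * p)) := by
  have hp0 : (0 : ℝ) ≤ p := p.2.1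
  unfold degreeDeviation
  rw [integral_finsetSum _ fun _ _ => Integrable.of_finite]
  have key : ∀ A ∈ (Finset.powersetCard k Finset.univ : Finset (Finset (Fin n))),
      ∫ H, subsetIndicator {A} H * ((hitCount (Finset.powersetCard k Aᶜ) H : ℝ)
        - (Finset.powersetCard k Aᶜ).card * p) ^ 2 ∂(randomHypergraph n k p)
      ≤ p * ((n - k).choose k * p) := by
    intro A hA
    have hA := Finset.mem_powersetCard_univ.1 hA
    rw [randomHypergraph, integral_subsetIndicator_mul_sq_sub p]
    · rw [Finset.card_singleton, pow_one, Finset.card_powersetCard, Finset.card_compl, hA,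
        Fintype.card_fin]
      refine mul_le_mul_of_nonneg_left ?_ hp0
      exact mul_le_of_le_one_right (by positivity) (by linarith)
    · simpa using hA
    · intro B hB
      exact (Finset.mem_powersetCard.1 hB).2
    · rw [Finset.disjoint_singleton_left, Finset.mem_powersetCard,
        Finset.subset_compl_iff_disjoint_left]
      exact fun h => ne_of_disjoint_of_card hk hA h.1 rfl
  refine (Finset.sum_le_sum key).trans (le_of_eq ?_)
  simp

open Classical in
/-- Markov's inequality for the number of edges of large degree. -/
theorem card_filter_degree_le (H : Set (Finset (Fin n))) {s : ℝ} (hs : 0 ≤ s) :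
    s ^ 2 * (((Finset.powersetCard k Finset.univ).filter fun A => A ∈ H ∧
      (n - k).choose k * (p : ℝ) + s < hitCount (Finset.powersetCard k Aᶜ) H).card : ℝ)
      ≤ degreeDeviation n k p H := by
  rw [Finset.card_filter]
  push_cast
  rw [Finset.mul_sum]
  refine Finset.sum_le_sum fun A hA => ?_
  have hA := Finset.mem_powersetCard_univ.1 hA
  split_ifs with h
  · rw [subsetIndicator_of_subset (by simpa using h.1), one_mul, mul_one,
      Finset.card_powersetCard, Finset.card_compl, hA, Fintype.card_fin]
    exact pow_le_pow_left₀ hs (by linarith [h.2]) 2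
  · rw [mul_zero]
    exact mul_nonneg (subsetIndicator_nonneg _ _) (sq_nonneg _)

/-- A sparse random Kneser graph with few triangles has a large independent set, by Shearer's
theorem. -/
theorem randomHypergraph_real_maxIntersecting_lt_shearer (hk : 1 ≤ k) (hkn : 2 * k ≤ n)
    (hp : 0 < (p : ℝ)) {δ : ℝ} (hδ : 0 < δ)
    (hlarge : 1 ≤ Real.log (p * (n - k).choose k)) :
    (randomHypergraph n k p).real
      {H | ¬ ((1 - 3 * δ) / (1 + δ) * ((n.choose k / (n - k).choose k : ℝ)
        * (Real.log (p * (n - k).choose k) - 1)) ≤ (maxIntersecting H : ℝ))}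
      ≤ 1 / (δ ^ 2 * (p * n.choose k)) + (n - k).choose k * (n - 2 * k).choose k * (p : ℝ) ^ 2 / δ
        + 1 / (δ ^ 3 * (p * (n - k).choose k)) := by
  classical
  have hNpos : (0 : ℝ) < n.choose k := by exact_mod_cast Nat.choose_pos (by omega)
  have hDpos : (0 : ℝ) < (n - k).choose k := by exact_mod_cast Nat.choose_pos (by omega)
  have hpos : 0 < (p : ℝ) * n.choose k := mul_pos hp hNpos
  have hpD : 0 < (p : ℝ) * (n - k).choose k := mul_pos hp hDpos
  set K := (Finset.powersetCard k Finset.univ : Finset (Finset (Fin n))) with hK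
  have htri0 : ∀ H, 0 ≤ triangleCount n k H := fun H => Finset.sum_nonneg fun A _ =>
    Finset.sum_nonneg fun B _ => Finset.sum_nonneg fun C _ => subsetIndicator_nonneg _ _
  have hp1 := randomHypergraph_real_hitCount p (k := k) (U := K)
      (fun A hA => Finset.mem_powersetCard_univ.1 hA) (m := n.choose k) (by simp [hK]) hpos hδ
  have hp2 := measureReal_le_integral_div (randomHypergraph n k p) htri0 (mul_pos hδ hpos)
    (E := {H | δ * (p * n.choose k) ≤ triangleCount n k H}) (fun H h => h)
  have hs : 0 < δ * (p * (n - k).choose k) := mul_pos hδ hpD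
  have hp3 := measureReal_le_integral_div (randomHypergraph n k p)
    (degreeDeviation_nonneg n k p) (c := (δ * (p * (n - k).choose k)) ^ 2 * (δ * (p * n.choose k)))
    (by positivity) (E := {H | (δ * (p * (n - k).choose k)) ^ 2 * (δ * (p * n.choose k))
      ≤ degreeDeviation n k p H}) (fun H h => h)
  rw [integral_triangleCount p hk] at hp2
  have hsimp2 : n.choose k * ((n - k).choose k * ((n - 2 * k).choose k * (p : ℝ) ^ 3))
      / (δ * (p * n.choose k)) = (n - k).choose k * (n - 2 * k).choose k * (p : ℝ) ^ 2 / δ := by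
    field_simp
  rw [hsimp2] at hp2
  replace hp3 := hp3.trans (div_le_div_of_nonneg_right (integral_degreeDeviation_le p hk)
    (by positivity))
  have hsimp3 : n.choose k * ((p : ℝ) * ((n - k).choose k * p))
      / ((δ * (p * (n - k).choose k)) ^ 2 * (δ * (p * n.choose k)))
      = 1 / (δ ^ 3 * (p * (n - k).choose k)) := by
    field_simp
  rw [hsimp3] at hp3
  refine le_trans (measureReal_mono fun H hH => ?_)
    ((measureReal_union_le _ _).trans (add_le_add
      ((measureReal_union_le _ _).trans (add_le_add hp1 hp2)) hp3))
  by_contra hcon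
  simp only [Set.mem_union, Set.mem_ofPred_eq, not_or, not_le] at hcon hH
  obtain ⟨⟨h1, h2⟩, h3⟩ := hcon
  set s := δ * (p * (n - k).choose k) with hsdef
  have hbad1 := card_filter_triangle_le (k := k) H
  have hbad2 := card_filter_degree_le (k := k) p H hs.le
  set B₁ := K.filter fun A => A ∈ H ∧ ∃ B ∈ H, ∃ C ∈ H,
      B.card = k ∧ C.card = k ∧ Disjoint A B ∧ Disjoint A C ∧ Disjoint B C with hB₁
  set B₂ := K.filter fun A => A ∈ H ∧
      (n - k).choose k * (p : ℝ) + s < hitCount (Finset.powersetCard k Aᶜ) H with hB₂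
  have hbad2' : (B₂.card : ℝ) < δ * (p * n.choose k) :=
    lt_of_mul_lt_mul_left (hbad2.trans_lt h3) (sq_nonneg s)
  set W := ((K.filter (· ∈ H)) \ B₁) \ B₂ with hW
  -- Each of three losses is at most `δpN`: the fluctuation of `|H|`, the vertices in triangles, and
  -- the vertices of degree above `(1+δ)pD`.
  have hWcard : (1 - 3 * δ) * (p * n.choose k) ≤ W.card := by
    have e1 := Finset.le_card_sdiff B₁ (K.filter (· ∈ H))
    have e2 := Finset.le_card_sdiff B₂ ((K.filter (· ∈ H)) \ B₁)
    rw [← hW] at e2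
    have e3 : hitCount K H ≤ W.card + B₁.card + B₂.card := by
      unfold hitCount
      have : (K.filter (· ∈ H)).card = (K.filter fun A => A ∈ H).card := rfl
      omega
    have e4 : (hitCount K H : ℝ) ≤ W.card + B₁.card + B₂.card := by exact_mod_cast e3
    have h7 := neg_le_abs ((hitCount K H : ℝ) - p * n.choose k)
    linarith
  have hWmem : ∀ A ∈ W, A.card = k ∧ A ∈ H ∧ A ∉ B₁ ∧ A ∉ B₂ := by
    intro A hA
    simp only [hW, Finset.mem_sdiff, Finset.mem_filter] at hA
    exact ⟨Finset.mem_powersetCard_univ.1 hA.1.1.1, hA.1.1.2, hA.1.2, hA.2⟩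
  have hWK : ∀ A ∈ W, A ∈ K := fun A hA => Finset.mem_powersetCard_univ.2 (hWmem A hA).1
  have hdpos : 0 < (1 + δ) * (p * (n - k).choose k) := by positivity
  obtain ⟨I, hIW, hI, hIcard⟩ := exists_indep_ge_of_triangleFree (adj := Disjoint)
    (S := W) (fun A B h => h.symm)
    (fun A hA h => ne_of_disjoint_of_card hk (hWmem A hA).1 h rfl)
    (fun A hA B hB C hC hAB hBC hAC => (hWmem A hA).2.2.1 (Finset.mem_filter.2 ⟨hWK A hA,
      (hWmem A hA).2.1, B, (hWmem B hB).2.1, C, (hWmem C hC).2.1, (hWmem B hB).1, (hWmem C hC).1,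
      hAB, hAC, hBC⟩)) hdpos
    (fun A hA B hBW hAB => by
      have hA2 := (hWmem A hA).2.2.2
      have hle : (B.card : ℝ) ≤ hitCount (Finset.powersetCard k Aᶜ) H := by
        unfold hitCount
        exact_mod_cast Finset.card_le_card fun C hC => Finset.mem_filter.2
          ⟨Finset.mem_powersetCard.2 ⟨Finset.subset_compl_iff_disjoint_left.2 (hAB C hC),
            (hWmem C (hBW hC)).1⟩, (hWmem C (hBW hC)).2.1⟩
      refine hle.trans ?_
      by_contra hgt
      rw [not_le] at hgt
      refine hA2 (Finset.mem_filter.2 ⟨hWK A hA, (hWmem A hA).2.1, lt_of_eq_of_lt ?_ hgt⟩)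
      rw [hsdef]; ring)
  have hImax : (I.card : ℝ) ≤ maxIntersecting H := by
    exact_mod_cast card_le_maxIntersecting (fun A hA => (hWmem A (hIW hA)).2.1) hI
  have hlog : Real.log (p * (n - k).choose k) ≤ Real.log ((1 + δ) * (p * (n - k).choose k)) :=
    Real.log_le_log hpD (by nlinarith)
  have hfinal : (1 - 3 * δ) / (1 + δ) * ((n.choose k / (n - k).choose k : ℝ)
        * (Real.log (p * (n - k).choose k) - 1))
      ≤ W.card * ((Real.log ((1 + δ) * (p * (n - k).choose k)) - 1)
        / ((1 + δ) * (p * (n - k).choose k))) := by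
    have : (1 - 3 * δ) / (1 + δ) * ((n.choose k / (n - k).choose k : ℝ)
        * (Real.log (p * (n - k).choose k) - 1))
        = (1 - 3 * δ) * (p * n.choose k) * ((Real.log (p * (n - k).choose k) - 1)
          / ((1 + δ) * (p * (n - k).choose k))) := by
      field_simp
    rw [this]
    refine mul_le_mul hWcard ?_ (div_nonneg (by linarith) hdpos.le) (Nat.cast_nonneg _)
    exact div_le_div_of_nonneg_right (by linarith) hdpos.le
  linarith

theorem kneser_degree_le_order : (n - k).choose k ≤ n.choose k :=
  Nat.choose_le_choose k (Nat.sub_le n k)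

/-- The container bound for intersecting families in the random hypergraph. Here `r` is the
relative size of the containers. -/
theorem randomHypergraph_real_maxIntersecting_ge (hk : 1 ≤ k) (hkn : 2 * k ≤ n)
    {δ r u θ t : ℝ} (q : ℕ) (hδ : 0 < δ) (hr : (1 + δ) * ((k : ℝ) / n) ≤ r)
    (hq : (n.choose k / (n - k).choose k : ℝ) * ((1 + δ) / δ) * Real.log (1 / r) ≤ q)
    (hu0 : 0 < u) (hu1 : u ≤ 1) (hθ : 0 ≤ θ) :
    (randomHypergraph n k p).real {H | t ≤ (maxIntersecting H : ℝ)}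
      ≤ Real.exp (q * Real.log (1 / u) + p * n.choose k * u
          + p * (r * n.choose k) * (Real.exp θ - 1) - θ * (t - q)) := by
  have hNpos : (0 : ℝ) < n.choose k := by exact_mod_cast Nat.choose_pos (by omega)
  have hDpos : (0 : ℝ) < (n - k).choose k := by exact_mod_cast Nat.choose_pos (by omega)
  have hDN : ((n - k).choose k : ℝ) ≤ n.choose k := by exact_mod_cast kneser_degree_le_order
  have hn0 : (0 : ℝ) < n := by exact_mod_cast (by omega : 0 < n)
  have hk0 : (0 : ℝ) < k := by exact_mod_cast hk
  have hkap : 0 < (k : ℝ) / n := by positivity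
  have hr0 : 0 < r := lt_of_lt_of_le (by positivity) hr
  set N : ℝ := ((n.choose k : ℕ) : ℝ) with hN
  set D : ℝ := (((n - k).choose k : ℕ) : ℝ) with hD
  -- Once `|S|/N > (1+δ)k/n`, subtracting `k/n` from `|S|/N` leaves at least the fraction `δ/(1+δ)`
  -- of it.
  set b : ℝ := D / N * (δ / (1 + δ)) with hb
  have hb0 : 0 < b := by positivity
  have hb1 : b ≤ 1 := by
    have h1 : D / N ≤ 1 := (div_le_one hNpos).2 hDN
    have h2 : δ / (1 + δ) ≤ 1 := (div_le_one (by positivity)).2 (by linarith)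
    exact mul_le_one₀ h1 (by positivity) h2
  have hcard : ((Finset.powersetCard k (Finset.univ : Finset (Fin n))).card : ℝ) = N := by
    simp [hN]
  have hmain := measureReal_exists_indep_le (adj := Disjoint) p
    (A := (Finset.powersetCard k Finset.univ : Finset (Finset (Fin n)))) (b := b) (R := r * N)
    (u := u) (θ := θ) (t := t) q hb1 (by positivity) (by
      intro S hSK hS
      have hSk : ∀ A ∈ S, A.card = k := fun A hA => Finset.mem_powersetCard_univ.1 (hSK hA)
      have hS' : (1 + δ) * ((k : ℝ) / n) < S.card / N :=
        hr.trans_lt ((lt_div_iff₀ hNpos).2 hS)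
      obtain ⟨A, hA, hdeg⟩ := exists_large_kneser_degree (Fintype.card_fin n) hk hkn hSk (by
        rw [← lt_div_iff₀ hNpos]
        nlinarith)
      refine ⟨A, hA, S.filter (Disjoint A), Finset.filter_subset _ _,
        fun B hB => (Finset.mem_filter.1 hB).2, le_trans ?_ hdeg⟩
      have h1 : b * S.card = D * (δ / (1 + δ) * (S.card / N)) := by rw [hb]; field_simp
      rw [h1]
      refine mul_le_mul_of_nonneg_left ?_ hDpos.le
      generalize (S.card : ℝ) / N = x at *
      rw [div_mul_eq_mul_div, div_le_iff₀ (by positivity)]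
      nlinarith) (by
      rw [hcard, mul_comm]
      refine mul_le_mul_of_nonneg_right ?_ hNpos.le
      -- After `q` shrinking steps the remaining fraction is at most `exp(-bq)`, and `q` is large
      -- enough for this to be at most `r`.
      have h1 : (1 - b) ^ q ≤ Real.exp (-b) ^ q :=
        pow_le_pow_left₀ (by linarith) (by linarith [Real.add_one_le_exp (-b)]) q
      refine h1.trans ?_
      rw [← Real.exp_nat_mul, ← Real.le_log_iff_exp_le hr0]
      have h2 := mul_le_mul_of_nonneg_left hq hb0.le
      have h3 : b * (N / D * ((1 + δ) / δ) * Real.log (1 / r)) = Real.log (1 / r) := by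
        rw [hb]; field_simp
      rw [h3, one_div, Real.log_inv] at h2
      linarith) hu0 hu1 hθ
  rw [hcard] at hmain
  refine le_trans ?_ hmain
  rw [randomHypergraph_eq]
  refine measureReal_mono fun H hH => ?_
  obtain ⟨F, hFH, hF, hcardF⟩ := exists_card_eq_maxIntersecting H
  refine ⟨F, hFH, hF, ?_⟩
  rw [hcardF]
  exact hH

end FiniteBounds

/-! ### Binomial ratios and the exponents of the container bound -/

section Estimates

/-- Factor by factor, `(a-j)/(m-j) ≤ a/m` when `a ≤ m`. -/
theorem descFactorial_mul_pow_le {a m : ℕ} (h : a ≤ m) (j : ℕ) :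
    a.descFactorial j * m ^ j ≤ m.descFactorial j * a ^ j := by
  induction j with
  | zero => simp
  | succ j ih =>
    rw [Nat.descFactorial_succ, Nat.descFactorial_succ, pow_succ, pow_succ]
    have h1 : (a - j) * m ≤ (m - j) * a := by
      rcases le_total a j with haj | haj
      · rw [Nat.sub_eq_zero_of_le haj]; simp
      · obtain ⟨c, rfl⟩ := Nat.exists_eq_add_of_le haj
        obtain ⟨e, rfl⟩ := Nat.exists_eq_add_of_le h
        rw [Nat.add_sub_cancel_left, show j + c + e - j = c + e by omega]
        nlinarith [Nat.zero_le (e * j)]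
    calc (a - j) * a.descFactorial j * (m ^ j * m)
        = ((a - j) * m) * (a.descFactorial j * m ^ j) := by ring
      _ ≤ ((m - j) * a) * (m.descFactorial j * a ^ j) := Nat.mul_le_mul h1 ih
      _ = _ := by ring

/-- Removing `k` points reduces the number of `k`-subsets by a factor of at least `exp (k^2/m)`. -/
theorem choose_sub_le_mul_exp {k m : ℕ} (hkm : k ≤ m) :
    ((m - k).choose k : ℝ) ≤ m.choose k * Real.exp (-((k : ℝ) ^ 2 / m)) := by
  rcases Nat.eq_zero_or_pos m with rfl | hm
  · simp [Nat.le_zero.1 hkm]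
  have hm0 : (0 : ℝ) < m := by exact_mod_cast hm
  have h1 := descFactorial_mul_pow_le (Nat.sub_le m k) k
  rw [Nat.descFactorial_eq_factorial_mul_choose, Nat.descFactorial_eq_factorial_mul_choose,
    mul_assoc, mul_assoc] at h1
  have h2 : (m - k).choose k * m ^ k ≤ m.choose k * (m - k) ^ k :=
    Nat.le_of_mul_le_mul_left h1 (Nat.factorial_pos k)
  have h3 : ((m - k).choose k : ℝ) * m ^ k ≤ m.choose k * (m - k) ^ k := by
    have : (((m - k).choose k * m ^ k : ℕ) : ℝ) ≤ ((m.choose k * (m - k) ^ k : ℕ) : ℝ) := by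
      exact_mod_cast h2
    push_cast [Nat.cast_sub hkm] at this
    exact this
  have h4 : ((m : ℝ) - k) ^ k ≤ m ^ k * Real.exp (-((k : ℝ) ^ 2 / m)) := by
    have h5 : ((m : ℝ) - k) ≤ m * Real.exp (-(k / m)) := by
      have := Real.add_one_le_exp (-((k : ℝ) / m))
      calc (m : ℝ) - k = m * (-(k / m) + 1) := by field_simp; ring
        _ ≤ _ := mul_le_mul_of_nonneg_left this hm0.le
    have h6 : (0 : ℝ) ≤ m - k := by
      rw [sub_nonneg]; exact_mod_cast hkm
    refine (pow_le_pow_left₀ h6 h5 k).trans (le_of_eq ?_)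
    rw [mul_pow, ← Real.exp_nat_mul]
    congr 2
    field_simp
  have h7 : ((m - k).choose k : ℝ) * m ^ k
      ≤ (m.choose k * Real.exp (-((k : ℝ) ^ 2 / m))) * m ^ k :=
    h3.trans ((mul_le_mul_of_nonneg_left h4 (Nat.cast_nonneg _)).trans (le_of_eq (by ring)))
  exact le_of_mul_le_mul_right h7 (by positivity)

theorem half_lt_log_of_two_le {x : ℝ} (hx : 2 ≤ x) : 1 / 2 < Real.log x := by
  have h1 := Real.log_two_gt_d9
  have h2 := Real.log_le_log (by norm_num) hx
  linarith

/-- The exponent in the container bound in the sparse range is negative. -/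
theorem sparse_exponent_le {ε ρ L C q : ℝ} (hε0 : 0 < ε) (hε1 : ε < 1) (hρ : 1 ≤ ρ) (hL : 1 ≤ L)
    (hq : q ≤ 3 * ρ * L / (1 - ε)) (hC : 3 / (1 - ε) + (1 - ε) / ε * (3 / (1 - ε) + 1) ≤ C) :
    q * L + ρ + 2 * ρ - ε * L / (1 - ε) * (C * ρ * L - q) ≤ ρ * (3 - L ^ 2) := by
  have he : 0 < 1 - ε := by linarith
  have h1 : q * L ≤ 3 * ρ * L / (1 - ε) * L := mul_le_mul_of_nonneg_right hq (by linarith)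
  have h2 : (3 / (1 - ε) + (1 - ε) / ε * (3 / (1 - ε) + 1)) * (ρ * L) ≤ C * (ρ * L) :=
    mul_le_mul_of_nonneg_right hC (by positivity)
  -- Multiplied by the tilt `θ = εL/(1-ε)`, this surplus is worth `ρL²(3/(1-ε) + 1)`: it pays the
  -- fingerprint cost `qL` and leaves `ρL²`.
  have h3 : (1 - ε) / ε * (3 / (1 - ε) + 1) * (ρ * L) ≤ C * ρ * L - q := by
    have : 3 * ρ * L / (1 - ε) = 3 / (1 - ε) * (ρ * L) := by field_simp
    rw [this] at hq
    linarith
  have h4 := mul_le_mul_of_nonneg_left h3 (by positivity : 0 ≤ ε * L / (1 - ε))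
  have h5 : ε * L / (1 - ε) * ((1 - ε) / ε * (3 / (1 - ε) + 1) * (ρ * L))
      = ρ * L ^ 2 * (3 / (1 - ε) + 1) := by
    generalize 3 / (1 - ε) + 1 = y
    field_simp
  have h6 : 3 * ρ * L / (1 - ε) * L = ρ * L ^ 2 * (3 / (1 - ε)) := by field_simp
  rw [h5] at h4
  rw [h6] at h1
  linarith

/-- The exponent in the container bound in the dense range is negative. -/
theorem dense_exponent_le {ε ρ l m q C K η v : ℝ} (hε0 : 0 < ε) (hε1 : ε < 1) (hρ : 1 ≤ ρ)
    (hl : 1 / 2 < l) (hK : 0 < K) (hη : η = ε ^ 2 / 64) (hC : K * (1 + 2 / η) / η ≤ C)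
    (hm : C * l ^ 2 ≤ m) (hq0 : 0 ≤ q) (hq : q ≤ K * ρ * l) (hv : v ≤ l + 1 / η) :
    q * v + η * (ρ * m) + (1 + ε / 4) * (ρ * m) * (Real.exp (ε / 4) - 1)
      - ε / 4 * ((1 + ε) * (ρ * m) - q) ≤ -(ε ^ 2 / 16) * (ρ * m) := by
  have hη0 : 0 < η := by rw [hη]; positivity
  have hl0 : 0 < l := by linarith
  have hC0 : 0 < C := lt_of_lt_of_le (by positivity) hC
  have hm0 : 0 < m := lt_of_lt_of_le (by positivity) hm
  have hρm : 0 < ρ * m := by positivity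
  have h0 : K * (1 + 2 / η) * ρ * l ^ 2 ≤ η * (ρ * m) := by
    rw [div_le_iff₀ hη0] at hC
    have h1 := mul_le_mul_of_nonneg_right hC (by positivity : 0 ≤ ρ * l ^ 2)
    have h2 := mul_le_mul_of_nonneg_left hm (by positivity : 0 ≤ η * ρ)
    linarith
  have hv' : v ≤ (1 + 2 / η) * l := by
    have : 1 / η ≤ 2 / η * l := by
      rw [div_mul_eq_mul_div]
      exact div_le_div_of_nonneg_right (by linarith) hη0.le
    linarith
  have h1 : q * v ≤ η * (ρ * m) := by
    refine (mul_le_mul_of_nonneg_left hv' hq0).trans ?_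
    refine (mul_le_mul_of_nonneg_right hq (by positivity)).trans ?_
    linarith
  have h2 : ε / 4 * q ≤ η * (ρ * m) := by
    have e1 : ε / 4 * q ≤ 1 * q := mul_le_mul_of_nonneg_right (by linarith) hq0
    have e2 : K * ρ * l ≤ K * (1 + 2 / η) * ρ * l ^ 2 := by
      have e3 : 1 ≤ (1 + 2 / η) * l := by
        have : 1 ≤ 1 / η := by
          rw [le_div_iff₀ hη0, hη]
          nlinarith
        have h4 : 2 / η = 2 * (1 / η) := by ring
        rw [h4]
        nlinarith
      have := mul_le_mul_of_nonneg_left e3 (by positivity : 0 ≤ K * ρ * l)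
      linarith
    linarith
  have h3 : Real.exp (ε / 4) - 1 ≤ ε / 4 + (ε / 4) ^ 2 := by
    have := Real.abs_exp_sub_one_sub_id_le (x := ε / 4) (by rw [abs_of_pos (by positivity)]; linarith)
    have := (abs_le.1 this).2
    linarith
  have h4 := mul_le_mul_of_nonneg_left h3 (by positivity : 0 ≤ (1 + ε / 4) * (ρ * m))
  -- With `η = ε²/64` the linear terms in `ε` cancel and the bracket equals `-5ε²/64 + ε³/64`, which
  -- is below `-ε²/16` since `ε < 1`.
  have h5 : (3 * η + (1 + ε / 4) * (ε / 4 + (ε / 4) ^ 2) - ε / 4 * (1 + ε)) * (ρ * m)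
      ≤ -(ε ^ 2 / 16) * (ρ * m) := by
    refine mul_le_mul_of_nonneg_right ?_ hρm.le
    rw [hη]
    nlinarith [mul_pos hε0 hε0, mul_pos (mul_pos hε0 hε0) hε0]
  linarith

end Estimates

/-! ### Choice of parameters in the two upper bounds -/

section UpperBounds

variable {n k : ℕ} (p : unitInterval)

/-- The upper bound in the sparse range. -/
theorem randomHypergraph_real_maxIntersecting_gt_sparse (hk : 1 ≤ k) (hkn : 2 * k ≤ n)
    {ε C : ℝ} (hε0 : 0 < ε) (hε1 : ε < 1)
    (hC : 3 / (1 - ε) + (1 - ε) / ε * (3 / (1 - ε) + 1) ≤ C)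
    (hL : 2 ≤ Real.log (p * (n - k).choose k)) (hp : 0 < (p : ℝ))
    (hp' : (p : ℝ) ≤ ((n : ℝ) / k) ^ (1 - ε) * ((n - k).choose k : ℝ)⁻¹) :
    (randomHypergraph n k p).real
      {H | ¬ ((maxIntersecting H : ℝ) ≤ C * (n.choose k / (n - k).choose k : ℝ)
        * Real.log (p * (n - k).choose k))}
      ≤ Real.exp (3 - Real.log (p * (n - k).choose k) ^ 2) := by
  have hNpos : (0 : ℝ) < n.choose k := by exact_mod_cast Nat.choose_pos (by omega)
  have hDpos : (0 : ℝ) < (n - k).choose k := by exact_mod_cast Nat.choose_pos (by omega)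
  have hDN : ((n - k).choose k : ℝ) ≤ n.choose k := by exact_mod_cast kneser_degree_le_order
  have hn0 : (0 : ℝ) < n := by exact_mod_cast (by omega : 0 < n)
  have hk0 : (0 : ℝ) < k := by exact_mod_cast hk
  have he : 0 < 1 - ε := by linarith
  set N : ℝ := ((n.choose k : ℕ) : ℝ) with hN
  set D : ℝ := (((n - k).choose k : ℕ) : ℝ) with hD
  set L := Real.log (p * D) with hLdef
  have hpD : 0 < (p : ℝ) * D := mul_pos hp hDpos
  have hexpL : Real.exp L = p * D := Real.exp_log hpD
  set ρ := N / D with hρ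
  have hρ1 : 1 ≤ ρ := (one_le_div hDpos).2 hDN
  -- The hypothesis on `p` says `L/(1-ε) ≤ ln(n/k)`, so this `r` is at least `2k/n` and `δ = 1` may
  -- be used.
  set r := 2 * Real.exp (-(L / (1 - ε))) with hr
  have hr0 : 0 < r := by positivity
  have hkr : (1 + 1) * ((k : ℝ) / n) ≤ r := by
    have h1 : (p : ℝ) * D ≤ ((n : ℝ) / k) ^ (1 - ε) := by
      rwa [← div_eq_mul_inv, le_div_iff₀ hDpos] at hp'
    have h2 : L ≤ (1 - ε) * Real.log ((n : ℝ) / k) := by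
      rw [← Real.log_rpow (by positivity)]
      exact Real.log_le_log hpD h1
    have h3 : L / (1 - ε) ≤ Real.log ((n : ℝ) / k) := by
      rw [div_le_iff₀ he]; linarith
    have h4 : (k : ℝ) / n = Real.exp (-Real.log ((n : ℝ) / k)) := by
      rw [Real.exp_neg, Real.exp_log (by positivity), inv_div]
    rw [hr, h4, one_add_one_eq_two]
    gcongr
  set q := ⌈ρ * ((1 + 1) / 1) * Real.log (1 / r)⌉₊ with hq
  have hlogr : Real.log (1 / r) ≤ L / (1 - ε) := by
    rw [one_div, Real.log_inv, hr, Real.log_mul (by norm_num) (Real.exp_pos _).ne', Real.log_exp]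
    have := Real.log_pos one_lt_two
    linarith
  have hqle : (q : ℝ) ≤ 3 * ρ * L / (1 - ε) := by
    have hLpos : 0 < L / (1 - ε) := by positivity
    have h1 : ρ * ((1 + 1) / 1) * Real.log (1 / r) ≤ ρ * 2 * (L / (1 - ε)) := by
      have : (1 + 1 : ℝ) / 1 = 2 := by norm_num
      rw [this]
      exact mul_le_mul_of_nonneg_left hlogr (by positivity)
    have h2 : (q : ℝ) ≤ ⌈ρ * 2 * (L / (1 - ε))⌉₊ := Nat.cast_le.2 (Nat.ceil_mono h1)
    have h3 := Nat.ceil_lt_add_one (by positivity : 0 ≤ ρ * 2 * (L / (1 - ε)))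
    have h4 : 1 ≤ ρ * (L / (1 - ε)) := by
      refine one_le_mul_of_one_le_of_one_le hρ1 ?_
      rw [le_div_iff₀ he]
      linarith
    have h5 : 3 * ρ * L / (1 - ε) = ρ * 2 * (L / (1 - ε)) + ρ * (L / (1 - ε)) := by ring
    linarith
  -- The parameters balance: `u = e^{-L}` makes `pNu = ρ`, and `θ = εL/(1-ε)` is the tilt at which
  -- `p·rN·e^θ` is exactly `2ρ`.
  have hmain := randomHypergraph_real_maxIntersecting_ge (n := n) (k := k) p hk hkn (δ := 1)
    (r := r) (u := Real.exp (-L)) (θ := ε * L / (1 - ε)) (t := C * ρ * L) q one_pos hkr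
    (Nat.le_ceil _) (Real.exp_pos _) (Real.exp_le_one_iff.2 (by linarith)) (by positivity)
  refine (measureReal_mono fun H hH => ?_).trans (hmain.trans (Real.exp_le_exp.2 ?_))
  · exact (not_le.1 hH).le
  · have hN' : (p : ℝ) * N = ρ * Real.exp L := by
      rw [hexpL, hρ]; field_simp
    have h1 : Real.log (1 / Real.exp (-L)) = L := by
      rw [one_div, Real.log_inv, Real.log_exp, neg_neg]
    have h2 : (p : ℝ) * N * Real.exp (-L) = ρ := by
      rw [hN', mul_assoc, ← Real.exp_add]; simp
    have h3 : p * (r * N) * (Real.exp (ε * L / (1 - ε)) - 1) ≤ 2 * ρ := by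
      have e1 : p * (r * N) * (Real.exp (ε * L / (1 - ε)) - 1)
          ≤ p * (r * N) * Real.exp (ε * L / (1 - ε)) :=
        mul_le_mul_of_nonneg_left (by linarith) (by positivity)
      refine e1.trans (le_of_eq ?_)
      have e2 : (p : ℝ) * (r * N) = 2 * ρ * (Real.exp L * Real.exp (-(L / (1 - ε)))) := by
        rw [hr]
        calc (p : ℝ) * (2 * Real.exp (-(L / (1 - ε))) * N)
            = 2 * (p * N) * Real.exp (-(L / (1 - ε))) := by ring
          _ = _ := by rw [hN']; ring
      rw [e2, mul_assoc, ← Real.exp_add, ← Real.exp_add]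
      have : L + -(L / (1 - ε)) + ε * L / (1 - ε) = 0 := by field_simp; ring
      rw [this, Real.exp_zero, mul_one]
    rw [h1, h2]
    have h4 := sparse_exponent_le (q := q) hε0 hε1 hρ1 (by linarith : 1 ≤ L) hqle hC
    have h6 : 3 - L ^ 2 ≤ 0 := by nlinarith
    have h5 : ρ * (3 - L ^ 2) ≤ 3 - L ^ 2 := by nlinarith
    linarith

/-- The upper bound in the dense range. -/
theorem randomHypergraph_real_maxIntersecting_gt_dense (hk : 1 ≤ k) (hkn : 2 * k ≤ n)
    {ε C : ℝ} (hε0 : 0 < ε) (hε1 : ε < 1)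
    (hC : ((1 + ε / 4) / (ε / 4) + 2) * (1 + 2 / (ε ^ 2 / 64)) / (ε ^ 2 / 64) ≤ C)
    (hp : C * ((n : ℝ) / k) * Real.log ((n : ℝ) / k) ^ 2 * ((n - k).choose k : ℝ)⁻¹ ≤ p) :
    (randomHypergraph n k p).real
      {H | ¬ ((maxIntersecting H : ℝ) ≤ (1 + ε) * (p * ((k : ℝ) / n) * n.choose k))}
      ≤ Real.exp (-(ε ^ 2 / 16) * (p * ((k : ℝ) / n) * n.choose k)) := by
  have hNpos : (0 : ℝ) < n.choose k := by exact_mod_cast Nat.choose_pos (by omega)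
  have hDpos : (0 : ℝ) < (n - k).choose k := by exact_mod_cast Nat.choose_pos (by omega)
  have hDN : ((n - k).choose k : ℝ) ≤ n.choose k := by exact_mod_cast kneser_degree_le_order
  have hn0 : (0 : ℝ) < n := by exact_mod_cast (by omega : 0 < n)
  have hk0 : (0 : ℝ) < k := by exact_mod_cast hk
  have h2kn : (2 : ℝ) ≤ (n : ℝ) / k := by
    rw [le_div_iff₀ hk0]; exact_mod_cast hkn
  set N : ℝ := ((n.choose k : ℕ) : ℝ) with hN
  set D : ℝ := (((n - k).choose k : ℕ) : ℝ) with hD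
  set l := Real.log ((n : ℝ) / k) with hldef
  have hl : 1 / 2 < l := half_lt_log_of_two_le h2kn
  set ρ := N / D with hρ
  have hρ1 : 1 ≤ ρ := (one_le_div hDpos).2 hDN
  set κ := (k : ℝ) / n with hκ
  have hκ0 : 0 < κ := by positivity
  have hinv : (n : ℝ) / k = κ⁻¹ := by rw [hκ, inv_div]
  have hκ1 : κ ≤ 1 := by
    rw [hκ, div_le_one hn0]; exact_mod_cast (by omega : k ≤ n)
  set m := (p : ℝ) * D * κ with hm
  have hm' : C * l ^ 2 ≤ m := by
    rw [hinv, ← div_eq_mul_inv, div_le_iff₀ hDpos] at hp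
    have := mul_le_mul_of_nonneg_right hp hκ0.le
    have e : C * κ⁻¹ * l ^ 2 * κ = C * l ^ 2 := by field_simp
    rw [e] at this
    exact this
  have hρm : (p : ℝ) * κ * N = ρ * m := by rw [hρ, hm]; field_simp
  set η := ε ^ 2 / 64 with hη
  have hη0 : 0 < η := by positivity
  have hη1 : η ≤ 1 := by rw [hη]; nlinarith
  -- The summand `2` pays for rounding `q` up, because `2ρl ≥ 1`.
  set K := (1 + ε / 4) / (ε / 4) + 2 with hK
  have hK0 : 0 < K := by positivity
  have hlκ : Real.log (1 / κ) = l := by rw [hldef, hinv, one_div]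
  set q := ⌈ρ * ((1 + ε / 4) / (ε / 4)) * Real.log (1 / ((1 + ε / 4) * κ))⌉₊ with hq
  have hlogr : Real.log (1 / ((1 + ε / 4) * κ)) ≤ l := by
    rw [← hlκ]
    refine Real.log_le_log (by positivity) ?_
    exact one_div_le_one_div_of_le hκ0 (by nlinarith)
  have hqle : (q : ℝ) ≤ K * ρ * l := by
    have h1 : ρ * ((1 + ε / 4) / (ε / 4)) * Real.log (1 / ((1 + ε / 4) * κ))
        ≤ ρ * ((1 + ε / 4) / (ε / 4)) * l := mul_le_mul_of_nonneg_left hlogr (by positivity)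
    have h2 : (q : ℝ) ≤ ⌈ρ * ((1 + ε / 4) / (ε / 4)) * l⌉₊ := Nat.cast_le.2 (Nat.ceil_mono h1)
    have h3 := Nat.ceil_lt_add_one (by positivity : 0 ≤ ρ * ((1 + ε / 4) / (ε / 4)) * l)
    have h4 : 1 ≤ 2 * ρ * l := by nlinarith
    have h5 : K * ρ * l = ρ * ((1 + ε / 4) / (ε / 4)) * l + 2 * ρ * l := by rw [hK]; ring
    linarith
  have hv : Real.log (1 / (η * κ)) ≤ l + 1 / η := by
    rw [one_div, mul_inv, Real.log_mul (by positivity) (by positivity), ← one_div, ← one_div κ,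
      hlκ]
    have := Real.log_le_sub_one_of_pos (by positivity : 0 < 1 / η)
    linarith
  have hmain := randomHypergraph_real_maxIntersecting_ge (n := n) (k := k) p hk hkn (δ := ε / 4)
    (r := (1 + ε / 4) * κ) (u := η * κ) (θ := ε / 4) (t := (1 + ε) * (p * κ * N)) q (by positivity)
    le_rfl (Nat.le_ceil _) (by positivity) (mul_le_one₀ hη1 hκ0.le hκ1) (by positivity)
  refine (measureReal_mono fun H hH => ?_).trans (hmain.trans (Real.exp_le_exp.2 ?_))
  · exact (not_le.1 hH).le
  · have h4 := dense_exponent_le (q := q) (v := Real.log (1 / (η * κ))) hε0 hε1 hρ1 hl hK0 hη hC hm'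
      (Nat.cast_nonneg _) hqle hv
    have h5 : (p : ℝ) * N * (η * κ) = η * (ρ * m) := by rw [← hρm]; ring
    have h6 : (p : ℝ) * ((1 + ε / 4) * κ * N) = (1 + ε / 4) * (ρ * m) := by rw [← hρm]; ring
    rw [h5, h6, hρm]
    exact h4

end UpperBounds

/-! ### The four ranges along sequences -/

section Sequences

variable {k : ℕ → ℕ} {p : ℕ → unitInterval}

theorem eventually_le_mul_of_inv_isLittleO {a p : ℕ → ℝ} (ha : ∀ᶠ n in atTop, 0 < a n)
    (hp : ∀ᶠ n in atTop, 0 < p n) (h : (fun n => (a n)⁻¹) =o[atTop] p) {K : ℝ} (hK : 0 < K) :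
    ∀ᶠ n in atTop, K ≤ p n * a n := by
  filter_upwards [ha, hp, isLittleO_iff.1 h (inv_pos.2 hK)] with n h1 h2 h3
  rw [Real.norm_of_nonneg (inv_pos.2 h1).le, Real.norm_of_nonneg h2.le, inv_eq_one_div,
    div_le_iff₀ h1, inv_mul_eq_div, div_mul_eq_mul_div, one_le_div hK] at h3
  exact h3

theorem eventually_mul_le_of_isLittleO_inv {a p : ℕ → ℝ} (ha : ∀ᶠ n in atTop, 0 < a n)
    (hp : ∀ᶠ n in atTop, 0 < p n) (h : p =o[atTop] fun n => (a n)⁻¹) {c : ℝ} (hc : 0 < c) :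
    ∀ᶠ n in atTop, p n * a n ≤ c := by
  filter_upwards [ha, hp, isLittleO_iff.1 h hc] with n h1 h2 h3
  rwa [Real.norm_of_nonneg (inv_pos.2 h1).le, Real.norm_of_nonneg h2.le, ← div_eq_mul_inv,
    le_div_iff₀ h1] at h3

theorem kneserDegree_pos {n : ℕ} (h : 2 * k n ≤ n) : 0 < kneserDegree k n := by
  unfold kneserDegree
  exact_mod_cast Nat.choose_pos (by omega)

theorem kneserOrder_pos {n : ℕ} (h : 2 * k n ≤ n) : 0 < kneserOrder k n := by
  unfold kneserOrder
  exact_mod_cast Nat.choose_pos (by omega)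

theorem kneserDegree_le_kneserOrder (n : ℕ) : kneserDegree k n ≤ kneserOrder k n := by
  unfold kneserDegree kneserOrder
  exact_mod_cast kneser_degree_le_order

theorem one_div_mul_le_of_le {a η x : ℝ} (ha : 0 < a) (hη : 0 < η) (hx : 1 / (a * η) ≤ x) :
    1 / (a * x) ≤ η := by
  rw [div_le_iff₀ (by positivity)] at hx
  have hx0 : 0 < x := by
    by_contra h
    nlinarith [mul_pos ha hη]
  rw [div_le_iff₀ (by positivity)]
  linarith

/-- The expected number of disjoint pairs is `pD` times `pN`, hence `o(pN)`, and deletion loses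
almost nothing; the upper bound is concentration of `|H|`. -/
theorem holdsAAS_very_sparse {ε : ℝ} (hε0 : 0 < ε)
    (hp : ∀ᶠ n : ℕ in atTop, 0 < (p n : ℝ))
    (hk : ∀ᶠ n : ℕ in atTop, 2 ≤ k n ∧ 2 * k n ≤ n)
    (h1 : (fun n => (kneserOrder k n)⁻¹) =o[atTop] (fun n => (p n : ℝ)))
    (h2 : (fun n => (p n : ℝ)) =o[atTop] (fun n => (kneserDegree k n)⁻¹)) :
    HoldsAAS k p (fun n H =>
      (1 - ε) * ((p n : ℝ) * kneserOrder k n) ≤ (maxIntersecting H : ℝ) ∧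
      (maxIntersecting H : ℝ) ≤ (1 + ε) * ((p n : ℝ) * kneserOrder k n)) := by
  have hN : ∀ᶠ n in atTop, 0 < kneserOrder k n := hk.mono fun n h => kneserOrder_pos h.2
  have hD : ∀ᶠ n in atTop, 0 < kneserDegree k n := hk.mono fun n h => kneserDegree_pos h.2
  refine HoldsAAS.and (fun η hη => ?_) (fun η hη => ?_)
  · have hε2 : 0 < ε / 2 := by positivity
    filter_upwards [hk, hN, hp,
      eventually_le_mul_of_inv_isLittleO hN hp h1 (K := 1 / ((ε / 2) ^ 2 * (η / 2))) (by positivity),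
      eventually_mul_le_of_isLittleO_inv hD hp h2 (c := ε / 2 * (η / 2)) (by positivity)]
      with n hk hN hp hpN hpD
    have := randomHypergraph_real_maxIntersecting_lt_deletion (n := n) (k := k n) (p n)
      (by omega) (mul_pos hp hN) hε2
    rw [show 1 - 2 * (ε / 2) = 1 - ε by ring] at this
    refine this.trans ?_
    have e1 := one_div_mul_le_of_le (by positivity : 0 < (ε / 2) ^ 2) (by positivity : 0 < η / 2) hpN
    have e2 : (p n : ℝ) * kneserDegree k n / (ε / 2) ≤ η / 2 := by
      rw [div_le_iff₀ hε2]; linarith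
    unfold kneserOrder at e1
    unfold kneserDegree at e2
    linarith
  · filter_upwards [hk, hN, hp,
      eventually_le_mul_of_inv_isLittleO hN hp h1 (K := 1 / (ε ^ 2 * η)) (by positivity)]
      with n hk hN hp hpN
    exact (randomHypergraph_real_maxIntersecting_gt (n := n) (k := k n) (p n)
      (mul_pos hp hN) hε0).trans (one_div_mul_le_of_le (by positivity) hη hpN)

/-- The size of `k` kills triangles, and `pD → ∞` gives degree concentration and absorbs the `-1` in
Shearer's bound. -/
theorem holdsAAS_sparse_lower {ε : ℝ} (hε0 : 0 < ε) (hε1 : ε < 1)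
    (hp : ∀ᶠ n : ℕ in atTop, 0 < (p n : ℝ))
    (hk : ∀ᶠ n : ℕ in atTop, 2 ≤ k n ∧ 2 * k n ≤ n)
    (h1 : (fun n => (kneserDegree k n)⁻¹) =o[atTop] (fun n => (p n : ℝ)))
    (h2 : ∀ᶠ n : ℕ in atTop, (p n : ℝ) ≤ ((n : ℝ) / (k n : ℝ)) * (kneserDegree k n)⁻¹)
    (h3 : (fun n : ℕ => Real.sqrt ((n : ℝ) * Real.log (n : ℝ))) =o[atTop]
      (fun n => (k n : ℝ))) :
    HoldsAAS k p (fun n H =>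
      (1 - ε) * (kneserOrder k n / kneserDegree k n)
          * Real.log ((p n : ℝ) * kneserDegree k n)
        ≤ (maxIntersecting H : ℝ)) := by
  have hD : ∀ᶠ n in atTop, 0 < kneserDegree k n := hk.mono fun n h => kneserDegree_pos h.2
  refine holdsAAS_of_forall_pos fun η hη => ?_
  obtain ⟨δ, hδ⟩ : ∃ δ, δ = ε / 16 := ⟨_, rfl⟩
  have hδ0 : 0 < δ := by rw [hδ]; positivity
  filter_upwards [hk, hp, h2, isLittleO_iff.1 h3 (show (0 : ℝ) < 1 / 2 by norm_num),
    eventually_le_mul_of_inv_isLittleO hD hp h1 (K := 1 / (δ ^ 2 * (η / 3))) (by positivity),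
    eventually_le_mul_of_inv_isLittleO hD hp h1 (K := 1 / (δ ^ 3 * (η / 3))) (by positivity),
    eventually_le_mul_of_inv_isLittleO hD hp h1 (K := Real.exp (2 / ε)) (by positivity),
    eventually_ge_atTop ⌈1 / (δ * (η / 3))⌉₊, eventually_ge_atTop 1]
    with n hk hp hp' hkn hpD1 hpD2 hpD3 hnbig hn1
  have hDpos := kneserDegree_pos hk.2
  have hNpos := kneserOrder_pos hk.2
  have hDN := kneserDegree_le_kneserOrder (k := k) n
  have hn0 : (1 : ℝ) ≤ n := by exact_mod_cast hn1
  have hk0 : (2 : ℝ) ≤ k n := by exact_mod_cast hk.1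
  have hL : 2 / ε ≤ Real.log (p n * kneserDegree k n) :=
    (Real.le_log_iff_exp_le (mul_pos hp hDpos)).2 hpD3
  have hL1 : 1 ≤ Real.log (p n * kneserDegree k n) := by
    refine le_trans ?_ hL
    rw [le_div_iff₀ hε0]; linarith
  have hmain := randomHypergraph_real_maxIntersecting_lt_shearer (n := n) (k := k n) (p n)
    (by omega) hk.2 hp hδ0 hL1
  refine le_trans (measureReal_mono fun H hH => ?_) (hmain.trans ?_)
  · simp only [Set.mem_ofPred_eq, not_le] at hH ⊢
    refine hH.trans_le ?_
    change (1 - ε) * (kneserOrder k n / kneserDegree k n)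
          * Real.log ((p n : ℝ) * kneserDegree k n) ≤ (1 - 3 * δ) / (1 + δ) *
          ((kneserOrder k n / kneserDegree k n) * (Real.log (p n * kneserDegree k n) - 1))
    generalize Real.log (p n * kneserDegree k n) = L at *
    have hρ : 0 < kneserOrder k n / kneserDegree k n := div_pos hNpos hDpos
    generalize kneserOrder k n / kneserDegree k n = ρ at *
    have e1 : 1 - ε / 4 ≤ (1 - 3 * δ) / (1 + δ) := by
      rw [le_div_iff₀ (by positivity), hδ]
      nlinarith
    have e2 : (1 - ε) * L ≤ (1 - ε / 4) * (L - 1) := by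
      rw [div_le_iff₀ hε0] at hL
      nlinarith
    have e3 : (1 - ε) * L ≤ (1 - 3 * δ) / (1 + δ) * (L - 1) :=
      e2.trans (mul_le_mul_of_nonneg_right e1 (by linarith))
    have := mul_le_mul_of_nonneg_left e3 hρ.le
    linarith
  · have e1 : 1 / (δ ^ 2 * (p n * kneserOrder k n)) ≤ η / 3 :=
      one_div_mul_le_of_le (by positivity) (by positivity)
        (hpD1.trans (mul_le_mul_of_nonneg_left hDN hp.le))
    have e3 : 1 / (δ ^ 3 * (p n * kneserDegree k n)) ≤ η / 3 :=
      one_div_mul_le_of_le (by positivity) (by positivity) hpD2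
    have hpD : (p n : ℝ) * kneserDegree k n ≤ n := by
      rw [← div_eq_mul_inv, le_div_iff₀ hDpos] at hp'
      exact hp'.trans (div_le_self (by linarith) (by linarith))
    have hlog : 4 * (n : ℝ) * Real.log n ≤ (k n : ℝ) ^ 2 := by
      rw [Real.norm_of_nonneg (Real.sqrt_nonneg _), Real.norm_of_nonneg (by linarith)] at hkn
      have h0 : 0 ≤ (n : ℝ) * Real.log n := mul_nonneg (by linarith) (Real.log_nonneg hn0)
      have := pow_le_pow_left₀ (Real.sqrt_nonneg _) hkn 2
      rw [Real.sq_sqrt h0] at this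
      linarith
    -- The exponent `3` suffices: since `pD ≤ n`, the expected number of triangles relative to `pN`
    -- is at most `(pD)²/n³ ≤ 1/n`.
    have htri : ((n - 2 * k n).choose (k n) : ℝ) ≤ kneserDegree k n * (1 / (n : ℝ) ^ 3) := by
      have h0 := choose_sub_le_mul_exp (k := k n) (m := n - k n) (by omega)
      rw [show n - k n - k n = n - 2 * k n by omega] at h0
      refine h0.trans (mul_le_mul_of_nonneg_left ?_ hDpos.le)
      have hm : (0 : ℝ) < ((n - k n : ℕ) : ℝ) := by exact_mod_cast (by omega : 0 < n - k n)
      have hmn : ((n - k n : ℕ) : ℝ) ≤ n := by exact_mod_cast Nat.sub_le n (k n)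
      have h1 : 3 * Real.log n ≤ (k n : ℝ) ^ 2 / ((n - k n : ℕ) : ℝ) := by
        rw [le_div_iff₀ hm]
        have := mul_le_mul_of_nonneg_left hmn (Real.log_nonneg hn0)
        nlinarith [Real.log_nonneg hn0]
      rw [one_div, ← Real.exp_log (by positivity : 0 < (n : ℝ) ^ 3), ← Real.exp_neg, Real.log_pow]
      refine Real.exp_le_exp.2 ?_
      push_cast
      linarith
    have e2 : kneserDegree k n * (n - 2 * k n).choose (k n) * (p n : ℝ) ^ 2 / δ ≤ η / 3 := by
      rw [div_le_iff₀ hδ0]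
      have hn' : 1 / (δ * (η / 3)) ≤ (n : ℝ) := (Nat.le_ceil _).trans (by exact_mod_cast hnbig)
      have h4 := one_div_mul_le_of_le hδ0 (by positivity : 0 < η / 3) hn'
      rw [div_le_iff₀ (by positivity)] at h4
      have h4' : 1 / (n : ℝ) ≤ η / 3 * δ := by
        rw [div_le_iff₀ (by positivity)]; linarith
      refine le_trans ?_ h4'
      calc kneserDegree k n * (n - 2 * k n).choose (k n) * (p n : ℝ) ^ 2
          ≤ kneserDegree k n * (kneserDegree k n * (1 / (n : ℝ) ^ 3)) * (p n : ℝ) ^ 2 := by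
            gcongr
        _ = (p n * kneserDegree k n) ^ 2 * (1 / (n : ℝ) ^ 3) := by ring
        _ ≤ (n : ℝ) ^ 2 * (1 / (n : ℝ) ^ 3) := by
            have := (mul_pos hp hDpos).le
            gcongr
        _ = 1 / n := by field_simp
    unfold kneserOrder at e1
    unfold kneserDegree at e2 e3
    linarith

theorem holdsAAS_sparse_upper {ε C : ℝ} (hε0 : 0 < ε) (hε1 : ε < 1)
    (hC : 3 / (1 - ε) + (1 - ε) / ε * (3 / (1 - ε) + 1) ≤ C)
    (hp : ∀ᶠ n : ℕ in atTop, 0 < (p n : ℝ))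
    (hk : ∀ᶠ n : ℕ in atTop, 2 ≤ k n ∧ 2 * k n ≤ n)
    (h1 : (fun n => (kneserDegree k n)⁻¹) =o[atTop] (fun n => (p n : ℝ)))
    (h2 : ∀ᶠ n : ℕ in atTop,
      (p n : ℝ) ≤ ((n : ℝ) / (k n : ℝ)) ^ (1 - ε) * (kneserDegree k n)⁻¹) :
    HoldsAAS k p (fun n H =>
      (maxIntersecting H : ℝ) ≤ C * (kneserOrder k n / kneserDegree k n)
        * Real.log ((p n : ℝ) * kneserDegree k n)) := by
  have hD : ∀ᶠ n in atTop, 0 < kneserDegree k n := hk.mono fun n h => kneserDegree_pos h.2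
  refine holdsAAS_of_forall_pos fun η hη => ?_
  filter_upwards [hk, hp, hD, h2, eventually_le_mul_of_inv_isLittleO hD hp h1
    (K := Real.exp (max 2 (3 - Real.log η))) (by positivity)] with n hk hp hD hp' hpD
  have hL : max 2 (3 - Real.log η) ≤ Real.log (p n * kneserDegree k n) :=
    (Real.le_log_iff_exp_le (mul_pos hp hD)).2 hpD
  have hL2 := (le_max_left _ _).trans hL
  have hL3 := (le_max_right _ _).trans hL
  refine (randomHypergraph_real_maxIntersecting_gt_sparse (n := n) (k := k n) (p n) (by omega)
    hk.2 hε0 hε1 hC hL2 hp hp').trans ?_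
  rw [← Real.le_log_iff_exp_le hη]
  change 3 - Real.log (p n * kneserDegree k n) ^ 2 ≤ Real.log η
  nlinarith

/-- In the dense range the expected size of a star tends to infinity. -/
theorem eventually_le_mul_sq_log (hk : ∀ᶠ n : ℕ in atTop, 2 ≤ k n ∧ 2 * k n ≤ n) {K : ℝ}
    (hK : 0 < K) : ∀ᶠ n : ℕ in atTop,
      K ≤ kneserOrder k n / kneserDegree k n * Real.log ((n : ℝ) / k n) ^ 2 := by
  set M := Real.exp (Real.sqrt K) with hM
  filter_upwards [hk, eventually_ge_atTop ⌈4 * K * M ^ 2⌉₊] with n hk hn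
  have hDpos := kneserDegree_pos hk.2
  have hDN := kneserDegree_le_kneserOrder (k := k) n
  have hn0 : (0 : ℝ) < n := by exact_mod_cast (by omega : 0 < n)
  have hk0 : (0 : ℝ) < k n := by exact_mod_cast (by omega : 0 < k n)
  have h2kn : (2 : ℝ) ≤ (n : ℝ) / k n := by
    rw [le_div_iff₀ hk0]; exact_mod_cast hk.2
  have hl := half_lt_log_of_two_le h2kn
  have hρ1 : 1 ≤ kneserOrder k n / kneserDegree k n := (one_le_div hDpos).2 hDN
  have hM0 : 0 < M := Real.exp_pos _
  -- Either `n/k` is so large that the logarithm alone suffices, or `k > n/M`; then `N/D ≥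
  -- exp(k²/n)` is at least `n/M²`, while the squared logarithm stays above `1/4`.
  by_cases hlarge : Real.sqrt K ≤ Real.log ((n : ℝ) / k n)
  · have h1 : K ≤ Real.log ((n : ℝ) / k n) ^ 2 := by
      have := pow_le_pow_left₀ (Real.sqrt_nonneg K) hlarge 2
      rwa [Real.sq_sqrt hK.le] at this
    nlinarith
  · rw [not_le, Real.log_lt_iff_lt_exp (by positivity), ← hM, div_lt_iff₀ hk0] at hlarge
    have h1 := choose_sub_le_mul_exp (k := k n) (m := n) (by omega)
    have h2 : (n : ℝ) / M ^ 2 ≤ (k n : ℝ) ^ 2 / n := by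
      rw [div_le_div_iff₀ (by positivity) hn0]
      nlinarith
    have h3 : (n : ℝ) / M ^ 2 ≤ kneserOrder k n / kneserDegree k n := by
      rw [le_div_iff₀ hDpos]
      have h4 := Real.add_one_le_exp ((k n : ℝ) ^ 2 / n)
      have h5 : kneserDegree k n * Real.exp ((k n : ℝ) ^ 2 / n) ≤ kneserOrder k n := by
        have := mul_le_mul_of_nonneg_right h1 (Real.exp_pos ((k n : ℝ) ^ 2 / n)).le
        rwa [mul_assoc, ← Real.exp_add, neg_add_cancel, Real.exp_zero, mul_one] at this
      nlinarith
    have h4 : 4 * K ≤ (n : ℝ) / M ^ 2 := by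
      rw [le_div_iff₀ (by positivity)]
      exact (Nat.le_ceil _).trans (by exact_mod_cast hn)
    have h5 : 1 / 4 ≤ Real.log ((n : ℝ) / k n) ^ 2 := by nlinarith
    have h6 := mul_le_mul (h4.trans h3) h5 (by norm_num) (by linarith)
    linarith

theorem holdsAAS_dense {ε C : ℝ} (hε0 : 0 < ε) (hε1 : ε < 1)
    (hC : ((1 + ε / 4) / (ε / 4) + 2) * (1 + 2 / (ε ^ 2 / 64)) / (ε ^ 2 / 64) ≤ C)
    (hk : ∀ᶠ n : ℕ in atTop, 2 ≤ k n ∧ 2 * k n ≤ n)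
    (h : ∀ᶠ n : ℕ in atTop,
      C * ((n : ℝ) / (k n : ℝ)) * Real.log ((n : ℝ) / (k n : ℝ)) ^ 2
        * (kneserDegree k n)⁻¹ ≤ (p n : ℝ)) :
    HoldsAAS k p (fun n H =>
      (1 - ε) * ((p n : ℝ) * ((k n : ℝ) / (n : ℝ)) * kneserOrder k n)
        ≤ (maxIntersecting H : ℝ) ∧
      (maxIntersecting H : ℝ) ≤
        (1 + ε) * ((p n : ℝ) * ((k n : ℝ) / (n : ℝ)) * kneserOrder k n)) := by
  have hC0 : 0 < C := lt_of_lt_of_le (by positivity) hC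
  -- The lower bound on `p` gives `p(k/n)N ≥ C(N/D) ln²(n/k)`, so the mean size of a star tends to
  -- infinity and both failure probabilities vanish.
  have hmean : ∀ K : ℝ, 0 < K → ∀ᶠ n in atTop,
      K ≤ (p n : ℝ) * ((k n : ℝ) / (n : ℝ)) * kneserOrder k n := by
    intro K hK
    filter_upwards [hk, h, eventually_le_mul_sq_log hk (div_pos hK hC0)] with n hk h hlog
    have hDpos := kneserDegree_pos hk.2
    have hNpos := kneserOrder_pos hk.2
    have hn0 : (0 : ℝ) < n := by exact_mod_cast (by omega : 0 < n)
    have hk0 : (0 : ℝ) < k n := by exact_mod_cast (by omega : 0 < k n)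
    rw [div_le_iff₀ hC0] at hlog
    refine hlog.trans ?_
    have := mul_le_mul_of_nonneg_right h
      (by positivity : 0 ≤ ((k n : ℝ) / (n : ℝ)) * kneserOrder k n)
    refine le_trans (le_of_eq ?_) (this.trans (le_of_eq (by ring)))
    field_simp
  refine HoldsAAS.and (fun η hη => ?_) (fun η hη => ?_)
  · filter_upwards [hk, hmean (1 / (ε ^ 2 * η)) (by positivity)] with n hk hK
    rw [mul_assoc] at hK
    have := randomHypergraph_real_maxIntersecting_lt_star (n := n) (k := k n) (p n) (by omega)
      (by omega) (lt_of_lt_of_le (by positivity) hK) hε0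
    simp only [mul_assoc]
    exact this.trans (one_div_mul_le_of_le (by positivity) hη hK)
  · filter_upwards [hk, h, hmean (max 1 (-(Real.log η) / (ε ^ 2 / 16)))
      (lt_of_lt_of_le one_pos (le_max_left _ _))] with n hk h hK
    refine (randomHypergraph_real_maxIntersecting_gt_dense (n := n) (k := k n) (p n) (by omega)
      hk.2 hε0 hε1 hC h).trans ?_
    rw [← Real.le_log_iff_exp_le hη]
    have := (le_max_right _ _).trans hK
    rw [div_le_iff₀ (by positivity)] at this
    unfold kneserOrder at this
    linarith

end Sequences

theorem theorem1 (ε : ℝ) (hε0 : 0 < ε) (hε1 : ε < 1) :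
    ∃ C : ℝ, 0 < C ∧
      ∀ (p : ℕ → unitInterval) (k : ℕ → ℕ),
        (∀ᶠ n : ℕ in atTop, 0 < (p n : ℝ) ∧ (p n : ℝ) < 1) →
        (∀ᶠ n : ℕ in atTop, 2 ≤ k n ∧ 2 * k n ≤ n) →
        -- (1)
        (((fun n => (kneserOrder k n)⁻¹) =o[atTop] (fun n => (p n : ℝ))) →
          ((fun n => (p n : ℝ)) =o[atTop] (fun n => (kneserDegree k n)⁻¹)) →
          HoldsAAS k p (fun n H =>
            (1 - ε) * ((p n : ℝ) * kneserOrder k n) ≤ (maxIntersecting H : ℝ) ∧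
            (maxIntersecting H : ℝ) ≤ (1 + ε) * ((p n : ℝ) * kneserOrder k n))) ∧
        -- (2)
        (((fun n => (kneserDegree k n)⁻¹) =o[atTop] (fun n => (p n : ℝ))) →
          (∀ᶠ n : ℕ in atTop, (p n : ℝ) ≤ ((n : ℝ) / (k n : ℝ)) * (kneserDegree k n)⁻¹) →
          ((fun n : ℕ => Real.sqrt ((n : ℝ) * Real.log (n : ℝ))) =o[atTop]
            (fun n => (k n : ℝ))) →
          HoldsAAS k p (fun n H =>
            (1 - ε) * (kneserOrder k n / kneserDegree k n)
                * Real.log ((p n : ℝ) * kneserDegree k n)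
              ≤ (maxIntersecting H : ℝ))) ∧
        -- (3)
        (((fun n => (kneserDegree k n)⁻¹) =o[atTop] (fun n => (p n : ℝ))) →
          (∀ᶠ n : ℕ in atTop,
            (p n : ℝ) ≤ ((n : ℝ) / (k n : ℝ)) ^ (1 - ε) * (kneserDegree k n)⁻¹) →
          HoldsAAS k p (fun n H =>
            (maxIntersecting H : ℝ) ≤
              C * (kneserOrder k n / kneserDegree k n)
                * Real.log ((p n : ℝ) * kneserDegree k n))) ∧
        -- (4)
        ((∀ᶠ n : ℕ in atTop,
            C * ((n : ℝ) / (k n : ℝ)) * Real.log ((n : ℝ) / (k n : ℝ)) ^ 2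
              * (kneserDegree k n)⁻¹ ≤ (p n : ℝ)) →
          HoldsAAS k p (fun n H =>
            (1 - ε) * ((p n : ℝ) * ((k n : ℝ) / (n : ℝ)) * kneserOrder k n)
              ≤ (maxIntersecting H : ℝ) ∧
            (maxIntersecting H : ℝ) ≤
              (1 + ε) * ((p n : ℝ) * ((k n : ℝ) / (n : ℝ)) * kneserOrder k n))) := by
  set C₁ := 3 / (1 - ε) + (1 - ε) / ε * (3 / (1 - ε) + 1) with hC₁
  set C₂ := ((1 + ε / 4) / (ε / 4) + 2) * (1 + 2 / (ε ^ 2 / 64)) / (ε ^ 2 / 64) with hC₂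
  -- The sparse and the dense upper bound accept any constant above `C₁` and `C₂` respectively, so
  -- one maximum serves both.
  refine ⟨max C₁ C₂, lt_of_lt_of_le (by positivity) (le_max_right _ _), fun p k hp hk => ?_⟩
  have hp0 : ∀ᶠ n : ℕ in atTop, 0 < (p n : ℝ) := hp.mono fun n h => h.1
  exact ⟨holdsAAS_very_sparse hε0 hp0 hk, holdsAAS_sparse_lower hε0 hε1 hp0 hk,
    holdsAAS_sparse_upper hε0 hε1 (le_max_left _ _) hp0 hk,
    holdsAAS_dense hε0 hε1 (le_max_right _ _) hk⟩
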